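/- Let $\mathcal O\subset\mathfrak{sl}_n(\mathbb C)$ be the $SL_n(\mathbb C)$-conjugacy class of a traceless complex matrix with simple spectrum, and let $\Lambda=\mathrm{diag}(\lambda_1,\dots,\lambda_n)\in\mathcal O$. Write $X^g=gXg^{-1}$. The Toda vector field is $X'=[X,\pi_{\mathfrak k}X]$, where $\pi_{\mathfrak k}$ is the projection of $\mathfrak{sl}_n(\mathbb C)$ onto the traceless skew-Hermitian matrices along the traceless upper triangular matrices with real diagonal. Let $K$ be the special unitary group, $U$ the group of determinant-one upper triangular matrices with positive diagonal entries, $L$ the group of lower triangular matrices with unit diagonal, and $\mathfrak l$ the space of strictly lower triangular matrices. Put $\mathcal C=\{k\in K: k=lu \text{ for some } l\in L,u\in U\}$ and $\mathcal D=\{u\in U: l=ku\text{ for some } l\in L,k\in K\}$. **Theorem.** The maps $\Phi_{\mathcal C}:\mathcal C\times L\to\mathcal O$, $(k,l)\mapsto\Lambda^{(lk)^{-1}}$, and $\Phi_{\mathcal D}:\mathcal D\times L\to\mathcal O$, $(u,l)\mapsto\Lambda^{ul^{-1}}$, are injective and have the same image $\mathcal U$, an open neighbourhood of $\Lambda$ in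 $\mathcal O$. The $(Y,Z)$ variables centered at $\Lambda$, $$\varphi:\mathcal U\to(\Lambda+\mathfrak l)\times(\Lambda+\mathfrak l),\qquad X=\Lambda^{(l_1k)^{-1}}=\Lambda^{ul_2^{-1}}\mapsto (Y,Z)=(\Lambda^{l_1^{-1}},\Lambda^{l_2^{-1}})\qquad(k\in\mathcal C,\ u\in\mathcal D,\ l_1,l_2\in L),$$ are a real analytic diffeomorphism with $\varphi(\Lambda)=(\Lambda,\Lambda)$. The Toda vector field is tangent to $\mathcal U$, and in these variables it is the linear vector field $$(Y',Z')=\big([Y,i\,\mathrm{Im}\,\Lambda],\,[Z,-\mathrm{Re}\,\Lambda]\big).$$ Moreover: 1. this linear vector field is defined on (and tangent to) the entire affine space $(\Lambda+\mathfrak l)\times(\Lambda+\mathfrak l)$, and through each point of that space there passes a unique trajectory defined for all $t\in\mathbb R$; 2. for each trajectory $t\mapsto(Y(t),Z(t))$, $t\in\mathbb R$, the set $\{Y(t):t\in\mathbb R\}$ has compact closure, and the set $\{Z(t):t\in\mathbb R\}$ is compact if and only if $Z(t)$ is constant in $t$; 3. it decouples in the strictly lower triangular entries of $Y$ and $Z$: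 for $j>k$, $$Y_{jk}'=i\,\mathrm{Im}(\lambda_k-\lambda_j)\,Y_{jk},\qquad Z_{jk}'=\mathrm{Re}(\lambda_j-\lambda_k)\,Z_{jk}.$$ -/

import Mathlib

open Set Topology Matrix
open scoped ComplexOrder

attribute [local instance] Matrix.normedAddCommGroup Matrix.normedSpace

namespace TodaYZ

/-- Square complex matrices of size `n`. -/
abbrev Mat (n : ℕ) := Matrix (Fin n) (Fin n) ℂ

/-- The group of complex matrices of determinant one. -/
abbrev SL (n : ℕ) := Matrix.SpecialLinearGroup (Fin n) ℂ

variable {n : ℕ}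

/-! ### The Toda vector field -/

/-- Traceless skew-Hermitian matrices. -/
def IsInK (A : Mat n) : Prop := A.trace = 0 ∧ Aᴴ = -A

/-- Traceless upper triangular matrices with real diagonal entries. -/
def IsInU (B : Mat n) : Prop :=
  B.trace = 0 ∧ (∀ i j, j < i → B i j = 0) ∧ ∀ i, (B i i).im = 0

/-- The projection onto the traceless skew-Hermitian matrices along the traceless upper triangular
matrices with real diagonal. See `piK_spec` and `piK_unique`. -/
noncomputable def piK (X : Mat n) : Mat n := Matrix.of fun i j =>
  if j < i then X i j else if i < j then -star (X j i) else Complex.I * ((X i i).im : ℂ)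

theorem piK_spec (X : Mat n) (hX : X.trace = 0) : IsInK (piK X) ∧ IsInU (X - piK X) := by
  have htr : (piK X).trace = 0 := by
    have h1 : (piK X).trace = Complex.I * ((X.trace).im : ℂ) := by
      simp [Matrix.trace, piK, Finset.mul_sum]
    simp [h1, hX]
  refine ⟨⟨htr, ?_⟩, ?_, ?_, ?_⟩
  · ext i j
    rcases lt_trichotomy i j with h | h | h
    · simp [piK, h, h.not_gt]
    · subst h
      simp [piK]
    · simp [piK, h, h.not_gt]
  · rw [Matrix.trace_sub, htr, hX, sub_zero]
  · intro i j h
    simp [piK, h]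
  · intro i
    simp [piK]

theorem piK_unique (X A B : Mat n) (hA : IsInK A) (hB : IsInU B) (hX : X = A + B) :
    A = piK X := by
  obtain ⟨-, hA⟩ := hA
  obtain ⟨-, hB, hBd⟩ := hB
  subst hX
  have hs : ∀ i j, star (A j i) = -A i j := fun i j => by
    have := congrFun (congrFun hA i) j
    simpa using this
  ext i j
  rcases lt_trichotomy i j with h | h | h
  · have h1 := hs i j
    have h2 := hB j i h
    simp only [piK, Matrix.of_apply, h, h.not_gt, if_true, if_false, Matrix.add_apply, h2,
      add_zero, h1, neg_neg]
  · subst h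
    have h1 := hs i i
    have h2 := hBd i
    have h3 : (A i i).re = 0 := by
      have := congrArg Complex.re h1
      simp at this
      linarith
    apply Complex.ext <;> simp [piK, h2, h3]
  · simp [piK, h, hB i j h]

/-- The Toda vector field `X ↦ [X, π_𝔨 X]`. -/
noncomputable def toda (X : Mat n) : Mat n := ⁅X, piK X⁆

/-! ### Conjugacy classes and the factors of the factorizations -/

/-- Conjugation, `X ↦ g X g⁻¹`. -/
def conj (g : SL n) (X : Mat n) : Mat n := (g : Mat n) * X * ((g⁻¹ : SL n) : Mat n)

/-- The conjugacy class of `X`. -/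
def conjClass (X : Mat n) : Set (Mat n) := Set.range fun g : SL n => conj g X

/-- All eigenvalues have algebraic multiplicity one. -/
def HasSimpleSpectrum (X : Mat n) : Prop := X.charpoly.roots.Nodup

/-- The special unitary group. -/
def grpK (n : ℕ) : Set (SL n) := {k | (k : Mat n) * (k : Mat n)ᴴ = 1}

/-- Upper triangular matrices with positive diagonal entries. -/
def grpU (n : ℕ) : Set (SL n) := {u | (∀ i j, j < i → u i j = 0) ∧ ∀ i, 0 < u i i}

/-- Lower triangular matrices with diagonal entries equal to one. -/
def grpL (n : ℕ) : Set (SL n) := {l | (∀ i j, i < j → l i j = 0) ∧ ∀ i, l i i = 1}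

/-- Special unitary matrices that have an `LU` factorization. -/
def setC (n : ℕ) : Set (SL n) := {k | k ∈ grpK n ∧ ∃ l ∈ grpL n, ∃ u ∈ grpU n, k = l * u}

/-- Upper triangular factors of the `QR` factorizations of the elements of `L`. -/
def setD (n : ℕ) : Set (SL n) := {u | u ∈ grpU n ∧ ∃ l ∈ grpL n, ∃ k ∈ grpK n, l = k * u}

/-! ### The `(Y, Z)` variables centered at `Λ` -/

/-- `(k, l) ↦ (l k)⁻¹ Λ (l k)`. -/
def phiC (Λ : Mat n) (p : SL n × SL n) : Mat n := conj (p.2 * p.1)⁻¹ Λ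

/-- `(u, l) ↦ (u l⁻¹) Λ (u l⁻¹)⁻¹`. -/
def phiD (Λ : Mat n) (p : SL n × SL n) : Mat n := conj (p.1 * p.2⁻¹) Λ

/-- The domain of the `(Y, Z)` variables. -/
def chartDomain (Λ : Mat n) : Set (Mat n) := phiC Λ '' (setC n ×ˢ grpL n)

/-- The `(Y, Z)` variables: if `X = (l₁ k)⁻¹ Λ (l₁ k) = (u l₂⁻¹) Λ (u l₂⁻¹)⁻¹` with `k ∈ C`,
`u ∈ D` and `l₁, l₂ ∈ L`, then `X` is sent to `(l₁⁻¹ Λ l₁, l₂⁻¹ Λ l₂)`. -/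
noncomputable def chart (Λ X : Mat n) : Mat n × Mat n :=
  (phiC Λ (1, (Function.invFunOn (phiC Λ) (setC n ×ˢ grpL n) X).2),
   phiD Λ (1, (Function.invFunOn (phiD Λ) (setD n ×ˢ grpL n) X).2))

/-- The strictly lower triangular matrices, as a real vector space. -/
def strictLower (n : ℕ) : Submodule ℝ (Mat n) where
  carrier := {Y | ∀ i j, i ≤ j → Y i j = 0}
  add_mem' := fun {a b} ha hb i j h => by simp [ha i j h, hb i j h]
  zero_mem' := fun _ _ _ => rfl
  smul_mem' := fun c a ha i j h => by simp [ha i j h]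

/-- The affine space of matrices `Λ + Y` with `Y` strictly lower triangular. -/
def affineLower (Λ : Mat n) : Set (Mat n) := {W | W - Λ ∈ strictLower n}

/-! ### The linear vector field -/

/-- The matrix of the real parts of the entries. -/
def reMat (Λ : Mat n) : Mat n := Λ.map fun z => (z.re : ℂ)

/-- The matrix of the imaginary parts of the entries. -/
def imMat (Λ : Mat n) : Mat n := Λ.map fun z => (z.im : ℂ)

/-- The linear vector field `(Y, Z) ↦ ([Y, i Im Λ], [Z, -Re Λ])`. -/
noncomputable def linField (Λ : Mat n) : (Mat n × Mat n) →ₗ[ℝ] (Mat n × Mat n) where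
  toFun p := (⁅p.1, Complex.I • imMat Λ⁆, ⁅p.2, -reMat Λ⁆)
  map_add' p q := by
    simp only [Ring.lie_def, Prod.fst_add, Prod.snd_add, add_mul, mul_add, Prod.mk_add_mk,
      add_sub_add_comm]
  map_smul' c p := by
    simp only [Ring.lie_def, Prod.smul_fst, Prod.smul_snd, smul_mul_assoc, mul_smul_comm,
      RingHom.id_apply, Prod.smul_mk, smul_sub, smul_comm c Complex.I]

/-- The map `f`, defined on the subset `S`, sends the vector field `v` to the vector field `w`:
at each point `x` of `S`, the vector `v x` is tangent to `S` and is sent to `w (f x)` by the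
differential of `f` along `S`. (Two derivatives of `f` within `S` at `x` agree on all vectors
that are tangent to `S` at `x`.) -/
def PushesForward {E F : Type*} [NormedAddCommGroup E] [NormedSpace ℝ E]
    [NormedAddCommGroup F] [NormedSpace ℝ F] (f : E → F) (S : Set E) (v : E → E) (w : F → F) :
    Prop :=
  ∀ x ∈ S, v x ∈ tangentConeAt ℝ S x ∧
    ∃ f' : E →L[ℝ] F, HasFDerivWithinAt f f' S x ∧ f' (v x) = w (f x)

/-- Trajectories, defined for all times, of the vector field `w` on the subset `S`. -/
def IsTrajectory {F : Type*} [NormedAddCommGroup F] [NormedSpace ℝ F] (w : F → F) (S : Set F)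
    (γ : ℝ → F) : Prop :=
  ∀ t, γ t ∈ S ∧ HasDerivAt γ (w (γ t)) t

end TodaYZ

open TodaYZ

/-!
The matrices `X` in the chart domain are the matrices `g⁻¹ * Λ * g` with `g = l₁ * k = l₂ * u⁻¹`,
where `l₁` and `l₂` are unit lower triangular, `k` is unitary and `u` is upper triangular with
positive diagonal (`IsFact`, `mem_chartDomain_iff`). Indeed, `k = l * u'` with `k ∈ C` gives
`l₁ * k = (l₁ * l) * u'`, and `l = k * u` with `u ∈ D` gives `l₂ * u⁻¹ = (l₂ * l⁻¹) * k`; so both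
parametrizations run through the same set of matrices `g`, and they have the same image.
Two such `g` with the same `X` differ by a left diagonal factor since `Λ` has simple spectrum. The
LU factorizations make this factor positive, and then the unitary factors make it trivial
(`IsFact.diagonal_eq_one`). This gives injectivity.

Every step of the construction of the variables is explicit and real analytic. The LU factorization
is given by the rational function `elim`, whose value at `l * u` is `l⁻¹`; together with square
roots of the pivots it gives the QR factorization (`cholInv`). For `X` near `g₀⁻¹ * Λ * g₀`, the
rows of `g₀` times the Lagrange polynomials in `X` are left eigenvectors of `X` (`eigenRows`). A
diagonal scaling of them that is analytic in `X` (`normalize`) yields `g`, and from `g` one reads off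
`l₁⁻¹ = elim (g * gᴴ)` and `l₂⁻¹ = elim g`. This proves analyticity of the chart and openness of its
domain. Conversely, `Y` and `Z` determine `l₁` and `l₂` polynomially, and the QR factorization
`l₁⁻¹ * l₂ = k * u` then determines `X`, whatever `Y` and `Z` are (`chartInv`).

For the vector field, let `exp (t * X) = k t * (v t)⁻¹` be the QR factorization. The curve
`(k t)⁻¹ * X * k t` has initial velocity `⁅X, piK X⁆`. It is conjugate to `Λ` by
`g * k t = exp (t * Λ) * g * v t`, and after multiplication by `exp (-i * t * Im Λ)` this matrix
has both factorizations, with lower triangular factors conjugate to those of `g` by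
`exp (-i * t * Im Λ)` and `exp (t * Re Λ)` (`todaFlow_chart`). So in the `(Y, Z)` variables the
curve is a trajectory of the linear field. The remaining claims follow from the explicit
exponentials that solve the linear field entry by entry (`linFlow`).
-/

namespace TodaYZ

variable {n : ℕ}

/-! ### Triangular matrices -/

/-- Lower triangular matrices with unit diagonal. -/
def UnitLower (A : Mat n) : Prop := A.IsLowerTriangular ∧ ∀ i, A i i = 1

/-- Upper triangular matrices with positive diagonal. -/
def PosUpper (A : Mat n) : Prop := A.IsUpperTriangular ∧ ∀ i, 0 < A i i

theorem upper_mul_diag {A B : Mat n} (hA : A.IsUpperTriangular) (hB : B.IsUpperTriangular)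
    (i : Fin n) : (A * B) i i = A i i * B i i := by
  rw [Matrix.mul_apply, Finset.sum_eq_single i]
  · intro j _ hj
    rcases lt_or_gt_of_ne hj with h | h
    · rw [hA h, zero_mul]
    · rw [hB h, mul_zero]
  · simp

theorem lower_mul_diag {A B : Mat n} (hA : A.IsLowerTriangular) (hB : B.IsLowerTriangular)
    (i : Fin n) : (A * B) i i = A i i * B i i := by
  rw [Matrix.mul_apply, Finset.sum_eq_single i]
  · intro j _ hj
    rcases lt_or_gt_of_ne hj with h | h
    · rw [hB h, mul_zero]
    · rw [hA h, zero_mul]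
  · simp

theorem upper_det_ne_zero {A : Mat n} (hA : A.IsUpperTriangular) (h : ∀ i, A i i ≠ 0) :
    A.det ≠ 0 := by
  rw [det_of_isUpperTriangular hA]
  exact Finset.prod_ne_zero_iff.2 fun i _ => h i

theorem lower_det_ne_zero {A : Mat n} (hA : A.IsLowerTriangular) (h : ∀ i, A i i ≠ 0) :
    A.det ≠ 0 := by
  rw [det_of_isLowerTriangular A hA]
  exact Finset.prod_ne_zero_iff.2 fun i _ => h i

theorem mul_inv_of_det {A : Mat n} (h : A.det ≠ 0) : A * A⁻¹ = 1 :=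
  Matrix.mul_nonsing_inv A (isUnit_iff_ne_zero.2 h)

theorem inv_mul_of_det {A : Mat n} (h : A.det ≠ 0) : A⁻¹ * A = 1 :=
  Matrix.nonsing_inv_mul A (isUnit_iff_ne_zero.2 h)

theorem inv_det_ne_zero {A : Mat n} (h : A.det ≠ 0) : A⁻¹.det ≠ 0 := by
  intro h0
  have := congrArg Matrix.det (mul_inv_of_det h)
  simp [h0] at this

theorem blockTriangular_inv {α : Type*} [LinearOrder α] {b : Fin n → α} {A : Mat n}
    (hA : A.BlockTriangular b) (h : A.det ≠ 0) : (A⁻¹).BlockTriangular b := by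
  have := A.invertibleOfIsUnitDet (isUnit_iff_ne_zero.2 h)
  exact blockTriangular_inv_of_blockTriangular hA

theorem upper_diag_ne_zero {A : Mat n} (hA : A.IsUpperTriangular) (h : A.det ≠ 0) (i : Fin n) :
    A i i ≠ 0 := by
  rw [det_of_isUpperTriangular hA] at h
  exact Finset.prod_ne_zero_iff.1 h i (Finset.mem_univ i)

theorem upper_inv_diag {A : Mat n} (hA : A.IsUpperTriangular) (h : A.det ≠ 0) (i : Fin n) :
    A⁻¹ i i = (A i i)⁻¹ := by
  have := upper_mul_diag hA (blockTriangular_inv hA h) i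
  rw [mul_inv_of_det h, Matrix.one_apply_eq] at this
  exact eq_inv_of_mul_eq_one_right this.symm

theorem eq_diagonal_of_upper_of_lower {A : Mat n} (hU : A.IsUpperTriangular)
    (hL : A.IsLowerTriangular) : A = Matrix.diagonal fun i => A i i := by
  ext i j
  rcases lt_trichotomy i j with h | h | h
  · rw [Matrix.diagonal_apply_ne _ h.ne, hL h]
  · subst h; simp
  · rw [Matrix.diagonal_apply_ne _ h.ne', hU h]

theorem conjTranspose_upper {A : Mat n} (hA : A.IsLowerTriangular) : (Aᴴ).IsUpperTriangular := by
  intro i j h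
  exact (congrArg star (hA h)).trans (star_zero ℂ)

theorem conjTranspose_lower {A : Mat n} (hA : A.IsUpperTriangular) : (Aᴴ).IsLowerTriangular := by
  intro i j h
  exact (congrArg star (hA h)).trans (star_zero ℂ)

theorem UnitLower.det {A : Mat n} (hA : UnitLower A) : A.det = 1 := by
  rw [det_of_isLowerTriangular A hA.1]
  exact Finset.prod_eq_one fun i _ => hA.2 i

theorem UnitLower.det_ne_zero {A : Mat n} (hA : UnitLower A) : A.det ≠ 0 := by
  rw [hA.det]; exact one_ne_zero

theorem UnitLower.one : UnitLower (1 : Mat n) := ⟨blockTriangular_one, fun _ => one_apply_eq _⟩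

theorem UnitLower.mul {A B : Mat n} (hA : UnitLower A) (hB : UnitLower B) : UnitLower (A * B) :=
  ⟨hA.1.mul hB.1, fun i => by rw [lower_mul_diag hA.1 hB.1, hA.2, hB.2, one_mul]⟩

theorem UnitLower.inv {A : Mat n} (hA : UnitLower A) : UnitLower A⁻¹ := by
  refine ⟨blockTriangular_inv hA.1 hA.det_ne_zero, fun i => ?_⟩
  have := lower_mul_diag hA.1 (blockTriangular_inv hA.1 hA.det_ne_zero) i
  rw [mul_inv_of_det hA.det_ne_zero, Matrix.one_apply_eq, hA.2, one_mul] at this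
  exact this.symm

theorem UnitLower.eq_one_of_upper {A : Mat n} (hA : UnitLower A) (hU : A.IsUpperTriangular) :
    A = 1 := by
  rw [eq_diagonal_of_upper_of_lower hU hA.1]
  simp [hA.2]

theorem PosUpper.det_pos {A : Mat n} (hA : PosUpper A) : 0 < A.det := by
  rw [det_of_isUpperTriangular hA.1]
  exact Finset.prod_pos fun i _ => hA.2 i

theorem PosUpper.mul {A B : Mat n} (hA : PosUpper A) (hB : PosUpper B) : PosUpper (A * B) :=
  ⟨hA.1.mul hB.1, fun i => by rw [upper_mul_diag hA.1 hB.1]; exact mul_pos (hA.2 i) (hB.2 i)⟩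

theorem PosUpper.inv {A : Mat n} (hA : PosUpper A) : PosUpper A⁻¹ := by
  refine ⟨blockTriangular_inv hA.1 hA.det_pos.ne', fun i => ?_⟩
  rw [upper_inv_diag hA.1 hA.det_pos.ne']
  exact inv_pos.2 (hA.2 i)

theorem conjTranspose_mul_self_of_unitary {A : Mat n} (h : A * Aᴴ = 1) : Aᴴ * A = 1 :=
  mul_eq_one_comm.1 h

/-- The inverse of `A` is both lower triangular and equal to `Aᴴ`, so `A` is diagonal, and its
diagonal entries have modulus one. -/
theorem eq_one_of_lower_of_unitary {A : Mat n} (hL : A.IsLowerTriangular) (hpos : ∀ i, 0 < A i i)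
    (hA : A * Aᴴ = 1) : A = 1 := by
  have hd : A.det ≠ 0 := lower_det_ne_zero hL fun i => (hpos i).ne'
  have hinv : A⁻¹ = Aᴴ := Matrix.inv_eq_right_inv hA
  have hU : A.IsUpperTriangular := by
    have := conjTranspose_upper (blockTriangular_inv hL hd)
    rwa [hinv, Matrix.conjTranspose_conjTranspose] at this
  have hdiag := eq_diagonal_of_upper_of_lower hU hL
  rw [hdiag, ← Matrix.diagonal_one]
  congr 1
  funext i
  have h1 : (A * Aᴴ) i i = 1 := by rw [hA, Matrix.one_apply_eq]
  rw [lower_mul_diag hL (hinv ▸ blockTriangular_inv hL hd), Matrix.conjTranspose_apply] at h1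
  obtain ⟨hr, him⟩ := Complex.lt_def.1 (hpos i)
  have h2 := congrArg Complex.re h1
  simp at hr him h2
  apply Complex.ext
  · rw [← him] at h2
    simp only [Complex.one_re]
    nlinarith
  · simp [← him]

/-! ### The elimination matrix of the LU factorization -/

/-- The leading block of `M` of size `i`, completed by an identity block. -/
def leadingBlock (i : Fin n) (M : Mat n) : Mat n := Matrix.of fun j k =>
  if j < i ∧ k < i then M j k else if j = k then 1 else 0

/-- The leading principal minors of `M` of size less than `n` do not vanish. -/
def HasMinors (M : Mat n) : Prop := ∀ i, (leadingBlock i M).det ≠ 0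

/-- The unit lower triangular matrix `E` for which `E * M` is upper triangular. Its row `i` is
obtained by solving the linear system of the leading block of size `i`. -/
noncomputable def elim (M : Mat n) : Mat n := Matrix.of fun i j =>
  (1 : Mat n) i j - ∑ k, if k < i then M i k * (leadingBlock i M)⁻¹ k j else 0

theorem leadingBlock_inv_apply {i : Fin n} {M : Mat n} {k j : Fin n} (hk : k < i)
    (hj : ¬ j < i) : (leadingBlock i M)⁻¹ k j = 0 := by
  by_cases h : IsUnit (leadingBlock i M).det
  swap
  · rw [Matrix.nonsing_inv_apply_not_isUnit _ h]; rfl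
  set P : Mat n := Matrix.diagonal (fun j => if j < i then 1 else 0) with hP
  -- The leading block commutes with the coordinate projection `P`, hence so does its inverse.
  have hc : leadingBlock i M * P = P * leadingBlock i M := by
    ext a b
    simp only [hP, Matrix.mul_diagonal, Matrix.diagonal_mul, leadingBlock, Matrix.of_apply]
    grind
  have hc' : (leadingBlock i M)⁻¹ * P = P * (leadingBlock i M)⁻¹ := by
    have h1 := Matrix.nonsing_inv_mul _ h
    have h2 := Matrix.mul_nonsing_inv _ h
    calc (leadingBlock i M)⁻¹ * P
        = (leadingBlock i M)⁻¹ * (P * leadingBlock i M) * (leadingBlock i M)⁻¹ := by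
          rw [mul_assoc, mul_assoc, h2, mul_one]
      _ = P * (leadingBlock i M)⁻¹ := by
          rw [← hc, ← mul_assoc, h1, one_mul]
  have := congrFun (congrFun hc' k) j
  rw [hP, Matrix.mul_diagonal, Matrix.diagonal_mul] at this
  simpa [hk, hj] using this.symm

theorem elim_unitLower (M : Mat n) : UnitLower (elim M) := by
  have key : ∀ i j, i ≤ j →
      (∑ k, if k < i then M i k * (leadingBlock i M)⁻¹ k j else 0) = 0 := by
    intro i j hij
    refine Finset.sum_eq_zero fun k _ => ?_
    split_ifs with hk
    · rw [leadingBlock_inv_apply hk hij.not_gt, mul_zero]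
    · rfl
  refine ⟨fun i j hij => ?_, fun i => ?_⟩
  · have hij' : i < j := hij
    simp [elim, key i j hij'.le, Matrix.one_apply_ne hij'.ne]
  · simp [elim, key i i le_rfl]

theorem elim_mul_upper {M : Mat n} (hM : HasMinors M) : (elim M * M).IsUpperTriangular := by
  intro i k hki
  have hki : k < i := hki
  have hT := inv_mul_of_det (hM i)
  have h1 : ∀ a, a < i → ∑ j, (leadingBlock i M)⁻¹ a j * M j k = (1 : Mat n) a k := by
    intro a ha
    rw [← hT, Matrix.mul_apply]
    refine Finset.sum_congr rfl fun j _ => ?_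
    by_cases hj : j < i
    · simp [leadingBlock, hj, hki]
    · rw [leadingBlock_inv_apply ha hj, zero_mul, zero_mul]
  have h2 : (elim M * M) i k = M i k -
      ∑ a, if a < i then M i a * ∑ j, (leadingBlock i M)⁻¹ a j * M j k else 0 := by
    rw [Matrix.mul_apply]
    simp only [elim, Matrix.of_apply, sub_mul, Finset.sum_sub_distrib, Finset.sum_mul]
    congr 1
    · simp [Matrix.one_apply]
    · rw [Finset.sum_comm]
      refine Finset.sum_congr rfl fun a _ => ?_
      split_ifs
      · rw [Finset.mul_sum]
        exact Finset.sum_congr rfl fun j _ => mul_assoc _ _ _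
      · simp
  -- By `h1` the inverse of the leading block cancels it, and only the term `M i k` survives.
  rw [h2, Finset.sum_eq_single k]
  · simp [hki, h1 k hki]
  · intro a _ hak
    split_ifs with ha
    · rw [h1 a ha, Matrix.one_apply_ne hak, mul_zero]
    · rfl
  · simp

theorem hasMinors_of_lower_mul_upper {A B : Mat n} (hA : A.IsLowerTriangular)
    (hB : B.IsUpperTriangular) (hA0 : ∀ i, A i i ≠ 0) (hB0 : ∀ i, B i i ≠ 0) :
    HasMinors (A * B) := by
  intro i
  -- For lower triangular `A` and upper triangular `B`, taking leading blocks is multiplicative.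
  have hmul : leadingBlock i (A * B) = leadingBlock i A * leadingBlock i B := by
    ext j k
    simp only [leadingBlock, Matrix.mul_apply, Matrix.of_apply]
    by_cases hj : j < i
    · by_cases hk : k < i
      · simp only [hj, hk, and_self, if_true, true_and, and_true]
        refine Finset.sum_congr rfl fun a _ => ?_
        by_cases ha : a < i
        · simp [ha]
        · have hja : j < a := hj.trans_le (not_lt.1 ha)
          rw [hA (show OrderDual.toDual a < OrderDual.toDual j from hja)]
          simp [ha, hja.ne]
      · have hjk : j ≠ k := by rintro rfl; exact hk hj
        simp only [hj, hk, and_false, if_false, hjk, true_and]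
        symm
        refine Finset.sum_eq_zero fun a _ => ?_
        by_cases ha : a < i
        · have : a ≠ k := by rintro rfl; exact hk ha
          simp [this]
        · have : j ≠ a := by rintro rfl; exact ha hj
          simp [ha, this]
    · simp only [hj, false_and, if_false]
      rw [Finset.sum_eq_single j]
      · simp [hj]
      · intro a _ ha
        simp [ha.symm]
      · simp
  rw [hmul, Matrix.det_mul]
  refine mul_ne_zero (lower_det_ne_zero ?_ fun j => ?_) (upper_det_ne_zero ?_ fun j => ?_)
  · intro j k hjk
    have hjk' : j < k := hjk
    simp [leadingBlock, hA hjk, hjk'.ne]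
  · by_cases hj : j < i <;> simp [leadingBlock, hj, hA0]
  · intro j k hjk
    have hjk' : k < j := hjk
    simp [leadingBlock, hB hjk, hjk'.ne']
  · by_cases hj : j < i <;> simp [leadingBlock, hj, hB0]

theorem hasMinors_of_posDef {M : Mat n} (hM : M.PosDef) : HasMinors M := by
  intro i h0
  obtain ⟨v, hv, hTv⟩ := Matrix.exists_mulVec_eq_zero_iff.2 h0
  have h1 : ∀ j, ¬ j < i → v j = 0 := by
    intro j hj
    have := congrFun hTv j
    simpa [Matrix.mulVec, dotProduct, leadingBlock, hj] using this
  have h2 : ∀ j, j < i → (M *ᵥ v) j = 0 := by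
    intro j hj
    have := congrFun hTv j
    rw [Pi.zero_apply] at this
    rw [← this]
    simp only [Matrix.mulVec, dotProduct]
    refine Finset.sum_congr rfl fun k _ => ?_
    by_cases hk : k < i
    · simp [leadingBlock, hj, hk]
    · simp [h1 k hk]
  -- A kernel vector `v` of the leading block is isotropic for `M`.
  have h3 : star v ⬝ᵥ (M *ᵥ v) = 0 := by
    refine Finset.sum_eq_zero fun j _ => ?_
    by_cases hj : j < i
    · rw [h2 j hj, mul_zero]
    · simp [h1 j hj]
  exact (hM.dotProduct_mulVec_pos hv).ne' h3

/-- The elimination matrix is the inverse of the lower triangular factor. -/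
theorem elim_mul {l u : Mat n} (hl : UnitLower l) (hu : u.IsUpperTriangular) (hu0 : u.det ≠ 0) :
    elim (l * u) = l⁻¹ := by
  have hM : HasMinors (l * u) := hasMinors_of_lower_mul_upper hl.1 hu
    (fun i => by rw [hl.2 i]; exact one_ne_zero) (upper_diag_ne_zero hu hu0)
  have h1 : (elim (l * u) * l).IsUpperTriangular := by
    have := (elim_mul_upper hM).mul (blockTriangular_inv hu hu0)
    rwa [mul_assoc, mul_assoc, mul_inv_of_det hu0, mul_one] at this
  have h2 := ((elim_unitLower (l * u)).mul hl).eq_one_of_upper h1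
  rw [Matrix.inv_eq_left_inv h2]

/-! ### QR factorizations and the normalization of eigenvector matrices -/

/-- The square roots of the inverses of the pivots of a positive definite matrix. -/
noncomputable def pivotScale (M : Mat n) (i : Fin n) : ℝ :=
  (√((elim M * M * (elim M)ᴴ) i i).re)⁻¹

/-- The inverse of the upper triangular Cholesky factor: `(cholInv M)ᴴ * M * cholInv M = 1`. -/
noncomputable def cholInv (M : Mat n) : Mat n :=
  (elim M)ᴴ * Matrix.diagonal fun i => (pivotScale M i : ℂ)

theorem pivot_posDef {M : Mat n} (hM : M.PosDef) : (elim M * M * (elim M)ᴴ).PosDef := by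
  refine hM.mul_mul_conjTranspose_same ?_
  rw [Matrix.vecMul_injective_iff_isUnit, Matrix.isUnit_iff_isUnit_det, (elim_unitLower M).det]
  exact isUnit_one

theorem pivot_re_pos {M : Mat n} (hM : M.PosDef) (i : Fin n) :
    0 < ((elim M * M * (elim M)ᴴ) i i).re := by
  exact (Complex.lt_def.1 ((pivot_posDef hM).diag_pos (i := i))).1

theorem pivotScale_pos {M : Mat n} (hM : M.PosDef) (i : Fin n) : 0 < pivotScale M i :=
  inv_pos.2 (Real.sqrt_pos.2 (pivot_re_pos hM i))

theorem pivot_eq_diagonal {M : Mat n} (hM : M.PosDef) :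
    elim M * M * (elim M)ᴴ = Matrix.diagonal fun i =>
      (((elim M * M * (elim M)ᴴ) i i).re : ℂ) := by
  have hH := (pivot_posDef hM).isHermitian
  have hU : (elim M * M * (elim M)ᴴ).IsUpperTriangular :=
    (elim_mul_upper (hasMinors_of_posDef hM)).mul (conjTranspose_upper (elim_unitLower M).1)
  have hL : (elim M * M * (elim M)ᴴ).IsLowerTriangular := by
    have := conjTranspose_lower hU
    rwa [hH.eq] at this
  rw [eq_diagonal_of_upper_of_lower hU hL]
  congr 1
  funext i
  rw [Matrix.diagonal_apply_eq]
  exact (hH.coe_re_apply_self i).symm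

theorem pivotScale_mul {M : Mat n} (hM : M.PosDef) :
    (Matrix.diagonal fun i => (pivotScale M i : ℂ)) * (elim M * M * (elim M)ᴴ) *
      (Matrix.diagonal fun i => (pivotScale M i : ℂ)) = 1 := by
  rw [pivot_eq_diagonal hM, Matrix.diagonal_mul_diagonal, Matrix.diagonal_mul_diagonal,
    ← Matrix.diagonal_one]
  congr 1
  funext i
  have h := pivot_re_pos hM i
  have h2 : pivotScale M i * ((elim M * M * (elim M)ᴴ) i i).re * pivotScale M i = 1 := by
    rw [pivotScale]
    have h3 := Real.mul_self_sqrt h.le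
    have h4 := (Real.sqrt_pos.2 h).ne'
    field_simp
    rw [sq, h3]
  exact_mod_cast h2

theorem diagonal_ofReal_conjTranspose (s : Fin n → ℝ) :
    (Matrix.diagonal fun i => (s i : ℂ))ᴴ = Matrix.diagonal fun i => (s i : ℂ) := by
  rw [Matrix.diagonal_conjTranspose]
  congr 1
  funext i
  simp

theorem cholInv_posUpper {M : Mat n} (hM : M.PosDef) : PosUpper (cholInv M) := by
  refine ⟨(conjTranspose_upper (elim_unitLower M).1).mul (blockTriangular_diagonal _), fun i => ?_⟩
  rw [cholInv, Matrix.mul_diagonal, Matrix.conjTranspose_apply, (elim_unitLower M).2, star_one,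
    one_mul]
  exact_mod_cast pivotScale_pos hM i

theorem cholInv_spec {M : Mat n} (hM : M.PosDef) : (cholInv M)ᴴ * M * cholInv M = 1 := by
  rw [cholInv, Matrix.conjTranspose_mul, diagonal_ofReal_conjTranspose,
    Matrix.conjTranspose_conjTranspose, ← pivotScale_mul hM]
  simp only [mul_assoc]

theorem gram_posDef {m : Mat n} (hm : m.det ≠ 0) : (mᴴ * m).PosDef := by
  refine Matrix.PosDef.conjTranspose_mul_self m ?_
  rw [Matrix.mulVec_injective_iff_isUnit, Matrix.isUnit_iff_isUnit_det]
  exact isUnit_iff_ne_zero.2 hm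

theorem gram_posDef' {m : Mat n} (hm : m.det ≠ 0) : (m * mᴴ).PosDef := by
  have h := gram_posDef (m := mᴴ) (by rw [Matrix.det_conjTranspose]; exact star_ne_zero.2 hm)
  rwa [Matrix.conjTranspose_conjTranspose] at h

/-- The unitary factor of the QR factorization of `m` is `m * cholInv (mᴴ * m)`. -/
theorem mul_cholInv_unitary {m : Mat n} (hm : m.det ≠ 0) :
    (m * cholInv (mᴴ * m)) * (m * cholInv (mᴴ * m))ᴴ = 1 := by
  rw [mul_eq_one_comm, Matrix.conjTranspose_mul]
  have := cholInv_spec (gram_posDef hm)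
  simpa only [mul_assoc] using this

/-- Uniqueness of the QR factorization. -/
theorem cholInv_gram {m k u : Mat n} (hk : k * kᴴ = 1) (hu : PosUpper u) (h : m = k * u) :
    cholInv (mᴴ * m) = u⁻¹ := by
  have hk' := conjTranspose_mul_self_of_unitary hk
  have hm : m.det ≠ 0 := by
    rw [h, Matrix.det_mul]
    refine mul_ne_zero (fun h0 => ?_) hu.det_pos.ne'
    have := congrArg Matrix.det hk
    simp [h0] at this
  have hW := cholInv_posUpper (gram_posDef hm)
  have hsp := cholInv_spec (gram_posDef hm)
  set W := cholInv (mᴴ * m)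
  have hmm : mᴴ * m = uᴴ * u := by
    rw [h, Matrix.conjTranspose_mul, mul_assoc, ← mul_assoc kᴴ, hk', one_mul]
  have hQ := hu.mul hW
  have h1 : (u * W)ᴴ * (u * W)ᴴᴴ = 1 := by
    rw [Matrix.conjTranspose_conjTranspose, Matrix.conjTranspose_mul, ← hsp, hmm]
    simp only [mul_assoc]
  have h2 : (u * W)ᴴ = 1 := by
    refine eq_one_of_lower_of_unitary (conjTranspose_lower hQ.1) (fun i => ?_) h1
    rw [Matrix.conjTranspose_apply]
    exact star_pos_iff.2 (hQ.2 i)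
  have h3 : u * W = 1 := by
    rw [← Matrix.conjTranspose_conjTranspose (u * W), h2, Matrix.conjTranspose_one]
  exact (Matrix.inv_eq_right_inv h3).symm

theorem cholInv_one : cholInv (1 : Mat n) = 1 := by
  have h := cholInv_gram (m := (1 : Mat n)) (k := 1) (u := 1) (by simp)
    ⟨blockTriangular_one, fun i => by simp⟩ (by simp)
  simpa using h

/-- The invertible matrices `g` that factor both as unit lower triangular times unitary and as
unit lower triangular times upper triangular with positive diagonal. If `Λ` is diagonal with
simple spectrum, every matrix in the chart domain is `g⁻¹ * Λ * g` for exactly one such `g`. -/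
def IsFact (g : Mat n) : Prop :=
  (∃ l k, UnitLower l ∧ k * kᴴ = 1 ∧ g = l * k) ∧ ∃ l v, UnitLower l ∧ PosUpper v ∧ g = l * v

theorem IsFact.det_ne_zero {g : Mat n} (hg : IsFact g) : g.det ≠ 0 := by
  obtain ⟨-, l, v, hl, hv, rfl⟩ := hg
  rw [Matrix.det_mul]
  exact mul_ne_zero hl.det_ne_zero hv.det_pos.ne'

theorem IsFact.hasMinors {g : Mat n} (hg : IsFact g) : HasMinors g := by
  obtain ⟨-, l, v, hl, hv, rfl⟩ := hg
  exact hasMinors_of_lower_mul_upper hl.1 hv.1 (fun i => by rw [hl.2 i]; exact one_ne_zero)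
    fun i => (hv.2 i).ne'

theorem elim_lower_mul_posUpper {l v : Mat n} (hl : UnitLower l) (hv : PosUpper v) :
    elim (l * v) = l⁻¹ := elim_mul hl hv.1 hv.det_pos.ne'

theorem elim_gram_lower_mul_unitary {l k : Mat n} (hl : UnitLower l) (hk : k * kᴴ = 1) :
    elim (l * k * (l * k)ᴴ) = l⁻¹ := by
  have : l * k * (l * k)ᴴ = l * lᴴ := by
    rw [Matrix.conjTranspose_mul, mul_assoc, ← mul_assoc k, hk, one_mul]
  rw [this]
  refine elim_mul hl (conjTranspose_upper hl.1) ?_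
  rw [Matrix.det_conjTranspose, hl.det]
  simp

theorem diag_mul_lower_mul {l l' : Mat n} (e : Fin n → ℂ) (hl : UnitLower l)
    (hl' : UnitLower l') : (l' * Matrix.diagonal e * l).IsLowerTriangular ∧
      ∀ i, (l' * Matrix.diagonal e * l) i i = e i := by
  have h1 : (l' * Matrix.diagonal e).IsLowerTriangular := hl'.1.mul (blockTriangular_diagonal _)
  refine ⟨h1.mul hl.1, fun i => ?_⟩
  rw [lower_mul_diag h1 hl.1, Matrix.mul_diagonal, hl'.2, hl.2, one_mul, mul_one]

/-- A left diagonal factor between two matrices with both factorizations is trivial: it is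
positive by the LU factorization, and then trivial because a lower triangular unitary matrix with
positive diagonal is. -/
theorem IsFact.diagonal_eq_one {g g' : Mat n} (hg : IsFact g) (hg' : IsFact g') {e : Fin n → ℂ}
    (h : g' = Matrix.diagonal e * g) : Matrix.diagonal e = 1 := by
  obtain ⟨⟨l₁, k, hl₁, hk, h₁⟩, l₂, v, hl₂, hv, h₂⟩ := hg
  obtain ⟨⟨l₁', k', hl₁', hk', h₁'⟩, l₂', v', hl₂', hv', h₂'⟩ := hg'
  -- Comparing LU factorizations shows that `e` is the diagonal of `v' * v⁻¹`.
  have hpos : ∀ i, 0 < e i := by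
    have hA : l₂'⁻¹ * Matrix.diagonal e * l₂ = v' * v⁻¹ := by
      calc l₂'⁻¹ * Matrix.diagonal e * l₂
          = l₂'⁻¹ * (Matrix.diagonal e * (l₂ * v)) * v⁻¹ := by
            simp only [mul_assoc, mul_inv_of_det hv.det_pos.ne', mul_one]
        _ = v' * v⁻¹ := by
            rw [← h₂, ← h, h₂', ← mul_assoc, inv_mul_of_det hl₂'.det_ne_zero, one_mul]
    intro i
    rw [← (diag_mul_lower_mul e hl₂ hl₂'.inv).2 i, hA]
    exact (hv'.mul hv.inv).2 i
  have hB := diag_mul_lower_mul e hl₁ hl₁'.inv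
  have hBk : l₁'⁻¹ * Matrix.diagonal e * l₁ = k' * kᴴ := by
    calc l₁'⁻¹ * Matrix.diagonal e * l₁
        = l₁'⁻¹ * (Matrix.diagonal e * (l₁ * k)) * kᴴ := by
          simp only [mul_assoc, hk, mul_one]
      _ = k' * kᴴ := by
          rw [← h₁, ← h, h₁', ← mul_assoc, inv_mul_of_det hl₁'.det_ne_zero, one_mul]
  have hBu : (k' * kᴴ) * (k' * kᴴ)ᴴ = 1 := by
    rw [Matrix.conjTranspose_mul, Matrix.conjTranspose_conjTranspose, mul_assoc, ← mul_assoc kᴴ,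
      conjTranspose_mul_self_of_unitary hk, one_mul, hk']
  have hone := eq_one_of_lower_of_unitary (hBk ▸ hB.1)
    (fun i => by rw [← hBk, hB.2 i]; exact hpos i) hBu
  rw [← Matrix.diagonal_one]
  congr 1
  funext i
  rw [← hB.2 i, hBk, hone, Matrix.one_apply_eq]

/-- The conjugate of the phase of `z`, written with a real square root. -/
noncomputable def invPhase (z : ℂ) : ℂ := star z * ((√(Complex.normSq z))⁻¹ : ℝ)

theorem invPhase_mul_self {z : ℂ} (hz : z ≠ 0) : 0 < invPhase z * z := by
  have h : 0 < Complex.normSq z := Complex.normSq_pos.2 hz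
  have h1 : invPhase z * z = ((√(Complex.normSq z))⁻¹ * Complex.normSq z : ℝ) := by
    rw [Complex.ofReal_mul, Complex.normSq_eq_conj_mul_self, invPhase]
    simp only [Complex.star_def]
    ring
  rw [h1]
  exact_mod_cast mul_pos (inv_pos.2 (Real.sqrt_pos.2 h)) h

theorem invPhase_mul_star {z : ℂ} (hz : z ≠ 0) : invPhase z * star (invPhase z) = 1 := by
  have h : 0 < Complex.normSq z := Complex.normSq_pos.2 hz
  have h1 : invPhase z * star (invPhase z) =
      ((√(Complex.normSq z))⁻¹ * (√(Complex.normSq z))⁻¹ * Complex.normSq z : ℝ) := by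
    rw [Complex.ofReal_mul, Complex.normSq_eq_conj_mul_self, invPhase]
    simp only [Complex.star_def, map_mul, Complex.conj_conj, Complex.conj_ofReal,
      Complex.ofReal_mul]
    ring
  rw [h1, ← mul_inv, Real.mul_self_sqrt h.le, inv_mul_cancel₀ h.ne', Complex.ofReal_one]

/-- The diagonal factor that turns `G` into a matrix with both factorizations. -/
noncomputable def normDiag (G : Mat n) (i : Fin n) : ℂ :=
  invPhase ((elim G * G) i i) * (pivotScale (G * Gᴴ) i : ℂ)

/-- The matrix with both factorizations that has the same rows as `G` up to scalars. -/
noncomputable def normalize (G : Mat n) : Mat n := Matrix.diagonal (normDiag G) * G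

theorem UnitLower.diagonal_conj {l : Mat n} (hl : UnitLower l) {d : Fin n → ℂ}
    (hd : ∀ i, d i ≠ 0) :
    UnitLower (Matrix.diagonal d * l * Matrix.diagonal fun i => (d i)⁻¹) := by
  refine ⟨((blockTriangular_diagonal _).mul hl.1).mul (blockTriangular_diagonal _), fun i => ?_⟩
  rw [Matrix.mul_diagonal, Matrix.diagonal_mul, hl.2, mul_one, mul_inv_cancel₀ (hd i)]

theorem diagonal_inv_mul_diagonal {d : Fin n → ℂ} (hd : ∀ i, d i ≠ 0) :
    (Matrix.diagonal fun i => (d i)⁻¹) * Matrix.diagonal d = 1 := by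
  rw [Matrix.diagonal_mul_diagonal, ← Matrix.diagonal_one]
  congr 1
  funext i
  exact inv_mul_cancel₀ (hd i)

theorem pivot_ne_zero {G : Mat n} (hG : HasMinors G) (hdet : G.det ≠ 0) (i : Fin n) :
    (elim G * G) i i ≠ 0 := by
  refine upper_diag_ne_zero (elim_mul_upper hG) ?_ i
  rw [Matrix.det_mul, (elim_unitLower G).det, one_mul]
  exact hdet

theorem normDiag_ne_zero {G : Mat n} (hG : HasMinors G) (hdet : G.det ≠ 0) (i : Fin n) :
    normDiag G i ≠ 0 := by
  refine mul_ne_zero ?_ ?_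
  · exact left_ne_zero_of_mul (invPhase_mul_self (pivot_ne_zero hG hdet i)).ne'
  · exact_mod_cast (pivotScale_pos (gram_posDef' hdet) i).ne'

/-- The scaling by the pivots of `G * Gᴴ` makes the factor next to a unit lower triangular matrix
unitary, and the phases, which preserve this, make the diagonal of the LU factor positive. -/
theorem normalize_isFact {G : Mat n} (hG : HasMinors G) (hdet : G.det ≠ 0) :
    IsFact (normalize G) := by
  have hd := normDiag_ne_zero hG hdet
  have hpd := gram_posDef' hdet
  have hu := pivot_ne_zero hG hdet
  have hinv := diagonal_inv_mul_diagonal hd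
  constructor
  · have hE := elim_unitLower (G * Gᴴ)
    refine ⟨_, (Matrix.diagonal fun i => invPhase ((elim G * G) i i)) *
      (Matrix.diagonal (fun i => (pivotScale (G * Gᴴ) i : ℂ)) * (elim (G * Gᴴ) * G)),
      hE.inv.diagonal_conj hd, ?_, ?_⟩
    · have h1 := pivotScale_mul hpd
      have h2 : (Matrix.diagonal fun i => invPhase ((elim G * G) i i)) *
          (Matrix.diagonal fun i => invPhase ((elim G * G) i i))ᴴ = 1 := by
        rw [Matrix.diagonal_conjTranspose, Matrix.diagonal_mul_diagonal, ← Matrix.diagonal_one]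
        congr 1
        funext i
        exact invPhase_mul_star (hu i)
      generalize (Matrix.diagonal fun i => invPhase ((elim G * G) i i)) = F at h2 ⊢
      have h3 := diagonal_ofReal_conjTranspose (pivotScale (G * Gᴴ))
      generalize (Matrix.diagonal fun i => (pivotScale (G * Gᴴ) i : ℂ)) = S at h1 h3 ⊢
      generalize elim (G * Gᴴ) = E at h1 ⊢
      calc F * (S * (E * G)) * (F * (S * (E * G)))ᴴ
          = F * (S * (E * (G * Gᴴ) * Eᴴ) * S) * Fᴴ := by
            simp only [Matrix.conjTranspose_mul, h3, mul_assoc]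
        _ = 1 := by rw [h1, mul_one, h2]
    · have h4 : (Matrix.diagonal fun i => invPhase ((elim G * G) i i)) *
          Matrix.diagonal (fun i => (pivotScale (G * Gᴴ) i : ℂ)) =
          Matrix.diagonal (normDiag G) := by
        rw [Matrix.diagonal_mul_diagonal]; rfl
      rw [← mul_assoc _ _ (elim (G * Gᴴ) * G), h4, mul_assoc, ← mul_assoc _ (diagonal (normDiag G)),
        hinv, one_mul, mul_assoc, ← mul_assoc _ (elim (G * Gᴴ)), inv_mul_of_det hE.det_ne_zero,
        one_mul]
      rfl
  · have hE := elim_unitLower G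
    refine ⟨_, Matrix.diagonal (normDiag G) * (elim G * G), hE.inv.diagonal_conj hd, ⟨?_, ?_⟩, ?_⟩
    · exact (blockTriangular_diagonal _).mul (elim_mul_upper hG)
    · intro i
      rw [Matrix.diagonal_mul, normDiag, mul_right_comm]
      refine mul_pos (invPhase_mul_self (hu i)) ?_
      exact_mod_cast pivotScale_pos hpd i
    · rw [mul_assoc, ← mul_assoc _ (diagonal (normDiag G)), hinv, one_mul, mul_assoc,
        ← mul_assoc _ (elim G), inv_mul_of_det hE.det_ne_zero, one_mul]
      rfl

/-- Normalization recovers `g` from any diagonal multiple of it. -/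
theorem normalize_diagonal_mul {g G : Mat n} (hg : IsFact g) {d : Fin n → ℂ}
    (h : G = Matrix.diagonal d * g) (hG : HasMinors G) (hdet : G.det ≠ 0) : normalize G = g := by
  have h1 : normalize G = Matrix.diagonal (fun i => normDiag G i * d i) * g := by
    rw [← Matrix.diagonal_mul_diagonal, mul_assoc, ← h]; rfl
  rw [h1, hg.diagonal_eq_one (normalize_isFact hG hdet) h1, one_mul]

/-! ### Real analytic matrix-valued functions -/

section MatAnalytic

variable {E : Type*} [NormedAddCommGroup E] [NormedSpace ℝ E] {x : E}

/-- Entrywise real analyticity. -/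
def MatAnalyticAt (f : E → Mat n) (x : E) : Prop := ∀ i j, AnalyticAt ℝ (fun y => f y i j) x

theorem matAnalyticAt_iff {f : E → Mat n} : MatAnalyticAt f x ↔ AnalyticAt ℝ f x := by
  constructor
  · intro h
    have h1 : ∀ i, AnalyticAt ℝ (fun y => f y i) x := fun i => AnalyticAt.pi (h i)
    exact AnalyticAt.pi h1
  · intro h i j
    have h1 : AnalyticAt ℝ (fun y => f y i) x :=
      ((ContinuousLinearMap.proj (R := ℝ) (φ := fun _ : Fin n => Fin n → ℂ) i).analyticAt
        (f x)).comp h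
    exact ((ContinuousLinearMap.proj (R := ℝ) (φ := fun _ : Fin n => ℂ) j).analyticAt _).comp h1

theorem analyticAt_re {f : E → ℂ} (h : AnalyticAt ℝ f x) : AnalyticAt ℝ (fun y => (f y).re) x :=
  (Complex.reCLM.analyticAt (f x)).comp h

theorem analyticAt_im {f : E → ℂ} (h : AnalyticAt ℝ f x) : AnalyticAt ℝ (fun y => (f y).im) x :=
  (Complex.imCLM.analyticAt (f x)).comp h

theorem analyticAt_star {f : E → ℂ} (h : AnalyticAt ℝ f x) :
    AnalyticAt ℝ (fun y => star (f y)) x :=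
  (Complex.conjCLE.toContinuousLinearMap.analyticAt (f x)).comp h

theorem analyticAt_ofReal {f : E → ℝ} (h : AnalyticAt ℝ f x) :
    AnalyticAt ℝ (fun y => (f y : ℂ)) x :=
  (Complex.ofRealCLM.analyticAt (f x)).comp h

theorem analyticAt_inv_sqrt {f : E → ℝ} (h : AnalyticAt ℝ f x) (h0 : 0 < f x) :
    AnalyticAt ℝ (fun y => (√(f y))⁻¹) x := by
  have h1 : AnalyticAt ℝ Real.sqrt (f x) := by
    have := (Real.contDiffAt_sqrt (n := ⊤) h0.ne').contDiffWithinAt (s := univ)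
    rw [← analyticWithinAt_univ]
    exact contDiffWithinAt_omega_iff_analyticWithinAt.1 this
  exact (h1.comp h).inv (Real.sqrt_pos.2 h0).ne'

theorem MatAnalyticAt.const (A : Mat n) : MatAnalyticAt (fun _ : E => A) x :=
  fun _ _ => analyticAt_const

theorem MatAnalyticAt.mul {f g : E → Mat n} (hf : MatAnalyticAt f x) (hg : MatAnalyticAt g x) :
    MatAnalyticAt (fun y => f y * g y) x := by
  intro i j
  simp only [Matrix.mul_apply]
  exact Finset.analyticAt_fun_sum _ fun k _ => (hf i k).mul (hg k j)

theorem MatAnalyticAt.conjTranspose {f : E → Mat n} (hf : MatAnalyticAt f x) :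
    MatAnalyticAt (fun y => (f y)ᴴ) x := fun i j => analyticAt_star (hf j i)

theorem MatAnalyticAt.det {f : E → Mat n} (hf : MatAnalyticAt f x) :
    AnalyticAt ℝ (fun y => (f y).det) x := by
  simp only [Matrix.det_apply']
  exact Finset.analyticAt_fun_sum _ fun σ _ =>
    analyticAt_const.mul (Finset.analyticAt_fun_prod _ fun i _ => hf _ _)

theorem MatAnalyticAt.inv {f : E → Mat n} (hf : MatAnalyticAt f x) (h0 : (f x).det ≠ 0) :
    MatAnalyticAt (fun y => (f y)⁻¹) x := by
  intro i j
  have h1 : (fun y => (f y)⁻¹ i j) = fun y =>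
      (f y).det⁻¹ * ((f y).updateRow j (Pi.single i 1)).det := by
    funext y
    rw [Matrix.inv_def, Matrix.smul_apply, Matrix.adjugate_apply, Ring.inverse_eq_inv', smul_eq_mul]
  rw [h1]
  refine (hf.det.inv h0).mul (MatAnalyticAt.det fun a b => ?_)
  by_cases h : a = j
  · subst h
    simp only [Matrix.updateRow_self]
    exact analyticAt_const
  · simp only [Matrix.updateRow_ne h]
    exact hf a b

theorem MatAnalyticAt.diagonal {f : E → Fin n → ℂ} (hf : ∀ i, AnalyticAt ℝ (fun y => f y i) x) :
    MatAnalyticAt (fun y => Matrix.diagonal (f y)) x := by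
  intro i j
  by_cases h : i = j
  · subst h
    simpa only [Matrix.diagonal_apply_eq] using hf i
  · simp only [Matrix.diagonal_apply_ne _ h]
    exact analyticAt_const

theorem MatAnalyticAt.leadingBlock {f : E → Mat n} (hf : MatAnalyticAt f x) (i : Fin n) :
    MatAnalyticAt (fun y => leadingBlock i (f y)) x := by
  intro j k
  simp only [TodaYZ.leadingBlock, Matrix.of_apply]
  split_ifs
  · exact hf j k
  · exact analyticAt_const
  · exact analyticAt_const

theorem MatAnalyticAt.elim {f : E → Mat n} (hf : MatAnalyticAt f x) (h0 : HasMinors (f x)) :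
    MatAnalyticAt (fun y => elim (f y)) x := by
  intro i j
  simp only [TodaYZ.elim, Matrix.of_apply]
  refine analyticAt_const.sub (Finset.analyticAt_fun_sum _ fun k _ => ?_)
  split_ifs
  · exact (hf i k).mul ((hf.leadingBlock i).inv (h0 i) k j)
  · exact analyticAt_const

theorem analyticAt_pivotScale {f : E → Mat n} (hf : MatAnalyticAt f x) (h0 : (f x).PosDef)
    (i : Fin n) : AnalyticAt ℝ (fun y => pivotScale (f y) i) x := by
  have hE := hf.elim (hasMinors_of_posDef h0)
  exact analyticAt_inv_sqrt (analyticAt_re (((hE.mul hf).mul hE.conjTranspose) i i))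
    (pivot_re_pos h0 i)

theorem MatAnalyticAt.cholInv {f : E → Mat n} (hf : MatAnalyticAt f x) (h0 : (f x).PosDef) :
    MatAnalyticAt (fun y => cholInv (f y)) x :=
  (hf.elim (hasMinors_of_posDef h0)).conjTranspose.mul
    (MatAnalyticAt.diagonal fun i => analyticAt_ofReal (analyticAt_pivotScale hf h0 i))

theorem analyticAt_invPhase {f : E → ℂ} (hf : AnalyticAt ℝ f x) (h0 : f x ≠ 0) :
    AnalyticAt ℝ (fun y => invPhase (f y)) x := by
  refine (analyticAt_star hf).mul (analyticAt_ofReal (analyticAt_inv_sqrt ?_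
    (Complex.normSq_pos.2 h0)))
  simp only [Complex.normSq_apply]
  exact ((analyticAt_re hf).mul (analyticAt_re hf)).add ((analyticAt_im hf).mul (analyticAt_im hf))

theorem MatAnalyticAt.normalize {f : E → Mat n} (hf : MatAnalyticAt f x)
    (h0 : HasMinors (f x)) (hdet : (f x).det ≠ 0) :
    MatAnalyticAt (fun y => normalize (f y)) x := by
  refine MatAnalyticAt.mul (MatAnalyticAt.diagonal fun i => ?_) hf
  exact (analyticAt_invPhase (((hf.elim h0).mul hf) i i) (pivot_ne_zero h0 hdet i)).mul
    (analyticAt_ofReal (analyticAt_pivotScale (hf.mul hf.conjTranspose) (gram_posDef' hdet) i))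

end MatAnalytic

/-! ### Left eigenvectors as polynomial functions of the matrix -/

theorem semiconj_aeval {g X A : Mat n} (h : g * X = A * g) (p : Polynomial ℂ) :
    g * Polynomial.aeval X p = Polynomial.aeval A p * g := by
  induction p using Polynomial.induction_on' with
  | add p q hp hq => rw [map_add, map_add, mul_add, add_mul, hp, hq]
  | monomial k a =>
    have hk : g * X ^ k = A ^ k * g := (SemiconjBy.pow_right (show SemiconjBy g X A from h) k)
    rw [Polynomial.aeval_monomial, Polynomial.aeval_monomial, mul_assoc, ← hk, ← mul_assoc,
      ← mul_assoc, Algebra.commutes]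

theorem aeval_diagonal (ev : Fin n → ℂ) (p : Polynomial ℂ) :
    Polynomial.aeval (Matrix.diagonal ev) p = Matrix.diagonal fun i => p.eval (ev i) := by
  induction p using Polynomial.induction_on' with
  | add p q hp hq => simp only [map_add, hp, hq, Matrix.diagonal_add, Polynomial.eval_add]
  | monomial k a =>
    rw [Polynomial.aeval_monomial, Matrix.diagonal_pow, Matrix.algebraMap_eq_diagonal,
      Matrix.diagonal_mul_diagonal]
    simp

theorem pow_lower {A : Mat n} (hA : A.IsLowerTriangular) (k : ℕ) :
    (A ^ k).IsLowerTriangular ∧ ∀ i, (A ^ k) i i = A i i ^ k := by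
  refine ⟨hA.pow k, fun i => ?_⟩
  induction k with
  | zero => simp
  | succ k ih => rw [pow_succ, lower_mul_diag (hA.pow k) hA, ih, pow_succ]

theorem aeval_lower {A : Mat n} (hA : A.IsLowerTriangular) (p : Polynomial ℂ) :
    (Polynomial.aeval A p).IsLowerTriangular ∧
      ∀ i, Polynomial.aeval A p i i = p.eval (A i i) := by
  induction p using Polynomial.induction_on' with
  | add p q hp hq =>
    rw [map_add]
    refine ⟨hp.1.add hq.1, fun i => ?_⟩
    rw [Matrix.add_apply, hp.2, hq.2, Polynomial.eval_add]
  | monomial k a =>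
    rw [Polynomial.aeval_monomial, Matrix.algebraMap_eq_diagonal]
    refine ⟨(blockTriangular_diagonal _).mul (hA.pow k), fun i => ?_⟩
    rw [Matrix.diagonal_mul, (pow_lower hA k).2]
    simp

/-- The matrix whose row `i` is row `i` of `g₀` times the Lagrange polynomial in `X` that projects
onto the eigenspace of `ev i`. If `X` has eigenvalues `ev`, row `i` lies in the left
eigenspace of `ev i`. -/
noncomputable def eigenRows (ev : Fin n → ℂ) (g₀ X : Mat n) : Mat n := Matrix.of fun i j =>
  (g₀ * Polynomial.aeval X (Lagrange.basis Finset.univ ev i)) i j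

theorem eigenRows_eq {ev : Fin n → ℂ} (hev : Function.Injective ev) (g₀ : Mat n) {g X : Mat n}
    (hg : g.det ≠ 0) (h : g * X = Matrix.diagonal ev * g) :
    eigenRows ev g₀ X = Matrix.diagonal (fun i => (g₀ * g⁻¹) i i) * g := by
  ext i j
  have h1 := semiconj_aeval h (Lagrange.basis Finset.univ ev i)
  rw [aeval_diagonal] at h1
  have h2 : g₀ * Polynomial.aeval X (Lagrange.basis Finset.univ ev i) = g₀ * g⁻¹ *
      ((Matrix.diagonal fun k => (Lagrange.basis Finset.univ ev i).eval (ev k)) * g) := by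
    rw [← h1, ← mul_assoc, mul_assoc g₀, inv_mul_of_det hg, mul_one]
  simp only [eigenRows, Matrix.of_apply]
  rw [h2, Matrix.mul_apply, Matrix.diagonal_mul, Finset.sum_eq_single i]
  · rw [Matrix.diagonal_mul, Lagrange.eval_basis_self hev.injOn (Finset.mem_univ i), one_mul]
  · intro k _ hk
    rw [Matrix.diagonal_mul, Lagrange.eval_basis_of_ne hk.symm (Finset.mem_univ k), zero_mul,
      mul_zero]
  · simp

theorem eigenRows_self {ev : Fin n → ℂ} (hev : Function.Injective ev) {g X : Mat n}
    (hg : g.det ≠ 0) (h : g * X = Matrix.diagonal ev * g) : eigenRows ev g X = g := by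
  rw [eigenRows_eq hev g hg h, mul_inv_of_det hg]
  simp

theorem eigenRows_one_lower {ev : Fin n → ℂ} (hev : Function.Injective ev) {l Y : Mat n}
    (hl : UnitLower l) (h : l * Y = Matrix.diagonal ev * l) : eigenRows ev 1 Y = l := by
  rw [eigenRows_eq hev 1 hl.det_ne_zero h]
  simp only [one_mul, hl.inv.2, Matrix.diagonal_one]

theorem eigenRows_unitLower {ev : Fin n → ℂ} (hev : Function.Injective ev) {Y : Mat n}
    (hY : Y.IsLowerTriangular) (hd : ∀ i, Y i i = ev i) : UnitLower (eigenRows ev 1 Y) := by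
  constructor
  · intro i j hij
    simp only [eigenRows, one_mul, Matrix.of_apply]
    exact (aeval_lower hY _).1 hij
  · intro i
    simp only [eigenRows, one_mul, Matrix.of_apply]
    rw [(aeval_lower hY _).2, hd, Lagrange.eval_basis_self hev.injOn (Finset.mem_univ i)]

/-- For a lower triangular matrix, this is the theorem of Cayley and Hamilton. -/
theorem eigenRows_mul {ev : Fin n → ℂ} {Y : Mat n} (hY : Y.IsLowerTriangular)
    (hd : ∀ i, Y i i = ev i) :
    eigenRows ev 1 Y * Y = Matrix.diagonal ev * eigenRows ev 1 Y := by
  have hchar : Y.charpoly = ∏ i, (Polynomial.X - Polynomial.C (ev i)) := by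
    rw [← Matrix.charpoly_transpose, Matrix.charpoly_of_isUpperTriangular Yᵀ
      (fun i j hij => hY hij)]
    simp [hd]
  have key : ∀ i, Polynomial.aeval Y (Lagrange.basis Finset.univ ev i) * Y =
      ev i • Polynomial.aeval Y (Lagrange.basis Finset.univ ev i) := by
    intro i
    have h1 : Lagrange.basis Finset.univ ev i * (Polynomial.X - Polynomial.C (ev i)) =
        (∏ j ∈ Finset.univ.erase i, Polynomial.C (ev i - ev j)⁻¹) * Y.charpoly := by
      rw [hchar, ← Finset.mul_prod_erase _ _ (Finset.mem_univ i), Lagrange.basis]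
      simp only [Lagrange.basisDivisor, Finset.prod_mul_distrib]
      ring
    have h2 := congrArg (Polynomial.aeval Y) h1
    rw [map_mul, map_mul, Matrix.aeval_self_charpoly, mul_zero, map_sub, Polynomial.aeval_X,
      Polynomial.aeval_C, mul_sub, sub_eq_zero, Algebra.algebraMap_eq_smul_one, mul_smul_comm,
      mul_one] at h2
    exact h2
  ext i j
  have h3 := congrFun (congrFun (key i) i) j
  rw [Matrix.diagonal_mul]
  simp only [eigenRows, one_mul, Matrix.of_apply]
  rw [Matrix.smul_apply, smul_eq_mul] at h3
  rw [← h3, Matrix.mul_apply, Matrix.mul_apply]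
  rfl

theorem MatAnalyticAt.aeval {E : Type*} [NormedAddCommGroup E] [NormedSpace ℝ E] {x : E}
    {f : E → Mat n} (hf : MatAnalyticAt f x) (p : Polynomial ℂ) :
    MatAnalyticAt (fun y => Polynomial.aeval (f y) p) x := by
  induction p using Polynomial.induction_on' with
  | add p q hp hq =>
    intro i j
    simp only [map_add, Matrix.add_apply]
    exact (hp i j).add (hq i j)
  | monomial k a =>
    simp only [Polynomial.aeval_monomial]
    refine (MatAnalyticAt.const _).mul ?_
    induction k with
    | zero => simpa only [pow_zero] using MatAnalyticAt.const 1
    | succ k ih =>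
      simp only [pow_succ]
      exact ih.mul hf

theorem MatAnalyticAt.eigenRows {E : Type*} [NormedAddCommGroup E] [NormedSpace ℝ E] {x : E}
    {f : E → Mat n} (hf : MatAnalyticAt f x) (ev : Fin n → ℂ) (g₀ : Mat n) :
    MatAnalyticAt (fun y => eigenRows ev g₀ (f y)) x :=
  fun i j => ((MatAnalyticAt.const g₀).mul (hf.aeval (Lagrange.basis Finset.univ ev i))) i j

/-! ### The two parametrizations -/

theorem sl_coe_inv (g : SL n) : ((g⁻¹ : SL n) : Mat n) = (g : Mat n)⁻¹ := by
  refine (Matrix.inv_eq_right_inv ?_).symm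
  rw [← Matrix.SpecialLinearGroup.coe_mul, mul_inv_cancel, Matrix.SpecialLinearGroup.coe_one]

theorem sl_det_ne_zero (g : SL n) : (g : Mat n).det ≠ 0 := by
  rw [g.det_coe]; exact one_ne_zero

theorem conj_inv_eq (g : SL n) (A : Mat n) : conj g⁻¹ A = (g : Mat n)⁻¹ * A * (g : Mat n) := by
  rw [conj, inv_inv, sl_coe_inv]

theorem phiC_eq (Λ : Mat n) (p : SL n × SL n) :
    phiC Λ p = ((p.2 * p.1 : SL n) : Mat n)⁻¹ * Λ * ((p.2 * p.1 : SL n) : Mat n) :=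
  conj_inv_eq _ _

theorem phiD_eq (Λ : Mat n) (p : SL n × SL n) :
    phiD Λ p = ((p.2 * p.1⁻¹ : SL n) : Mat n)⁻¹ * Λ * ((p.2 * p.1⁻¹ : SL n) : Mat n) := by
  rw [← conj_inv_eq, _root_.mul_inv_rev, inv_inv]
  rfl

theorem unitLower_of_mem {l : SL n} (hl : l ∈ grpL n) : UnitLower (l : Mat n) :=
  ⟨fun i j h => hl.1 i j h, hl.2⟩

theorem posUpper_of_mem {u : SL n} (hu : u ∈ grpU n) : PosUpper (u : Mat n) :=
  ⟨fun i j h => hu.1 i j h, hu.2⟩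

/-- The determinant of such a matrix is positive and of modulus one. -/
theorem IsFact.det {g : Mat n} (hg : IsFact g) : g.det = 1 := by
  obtain ⟨⟨l₁, k, hl₁, hk, h₁⟩, l₂, v, hl₂, hv, h₂⟩ := hg
  have h3 : k.det = g.det := by rw [h₁, Matrix.det_mul, hl₁.det, one_mul]
  have h4 : v.det = g.det := by rw [h₂, Matrix.det_mul, hl₂.det, one_mul]
  have hpos := hv.det_pos
  have h5 := congrArg Matrix.det hk
  rw [Matrix.det_mul, Matrix.det_conjTranspose, Matrix.det_one, h3] at h5
  rw [h4] at hpos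
  obtain ⟨hr, him⟩ := Complex.lt_def.1 hpos
  have h6 := congrArg Complex.re h5
  simp at hr him h6
  apply Complex.ext
  · rw [← him] at h6
    simp only [Complex.one_re]
    nlinarith
  · simp [← him]

theorem isFact_of_setC {p : SL n × SL n} (hp : p ∈ setC n ×ˢ grpL n) :
    IsFact ((p.2 * p.1 : SL n) : Mat n) := by
  obtain ⟨⟨hk, l, hl, u, hu, h⟩, hp2⟩ := hp
  refine ⟨⟨p.2, p.1, unitLower_of_mem hp2, hk, Matrix.SpecialLinearGroup.coe_mul _ _⟩,
    p.2 * l, u, (unitLower_of_mem hp2).mul (unitLower_of_mem hl), posUpper_of_mem hu, ?_⟩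
  rw [h, ← mul_assoc, Matrix.SpecialLinearGroup.coe_mul, Matrix.SpecialLinearGroup.coe_mul]

theorem isFact_of_setD {p : SL n × SL n} (hp : p ∈ setD n ×ˢ grpL n) :
    IsFact ((p.2 * p.1⁻¹ : SL n) : Mat n) := by
  obtain ⟨⟨hu, l, hl, k, hk, h⟩, hp2⟩ := hp
  refine ⟨⟨p.2 * (l : Mat n)⁻¹, k, (unitLower_of_mem hp2).mul (unitLower_of_mem hl).inv, hk, ?_⟩,
    p.2, (p.1 : Mat n)⁻¹, unitLower_of_mem hp2, (posUpper_of_mem hu).inv, ?_⟩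
  · have h1 : p.1⁻¹ = l⁻¹ * k := by rw [h, _root_.mul_inv_rev, inv_mul_cancel_right]
    rw [h1, ← mul_assoc, Matrix.SpecialLinearGroup.coe_mul, Matrix.SpecialLinearGroup.coe_mul,
      sl_coe_inv]
  · rw [Matrix.SpecialLinearGroup.coe_mul, sl_coe_inv]

theorem UnitLower.exists_sl {l : Mat n} (hl : UnitLower l) :
    ∃ l' ∈ grpL n, (l' : Mat n) = l :=
  ⟨⟨l, hl.det⟩, ⟨fun _ _ h => hl.1 h, hl.2⟩, rfl⟩

theorem PosUpper.exists_sl {u : Mat n} (hu : PosUpper u) (h : u.det = 1) :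
    ∃ u' ∈ grpU n, (u' : Mat n) = u :=
  ⟨⟨u, h⟩, ⟨fun _ _ h => hu.1 h, hu.2⟩, rfl⟩

/-- The factors of `g` as elements of the groups `L`, `K`, `L` and `U`. -/
theorem IsFact.exists_sl {g : Mat n} (hg : IsFact g) :
    ∃ l₁ ∈ grpL n, ∃ k ∈ setC n, ∃ l₂ ∈ grpL n, ∃ u ∈ setD n,
      ((l₁ * k : SL n) : Mat n) = g ∧ ((l₂ * u⁻¹ : SL n) : Mat n) = g := by
  have hdet := hg.det
  obtain ⟨⟨l₁, k, hl₁, hk, h₁⟩, l₂, v, hl₂, hv, h₂⟩ := hg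
  have hkd : k.det = 1 := by rw [← hdet, h₁, Matrix.det_mul, hl₁.det, one_mul]
  have hvd : v.det = 1 := by rw [← hdet, h₂, Matrix.det_mul, hl₂.det, one_mul]
  obtain ⟨l₁, hl₁', rfl⟩ := hl₁.exists_sl
  obtain ⟨l₂, hl₂', rfl⟩ := hl₂.exists_sl
  obtain ⟨v, hv', rfl⟩ := hv.exists_sl hvd
  obtain ⟨k, rfl⟩ : ∃ k' : SL n, (k' : Mat n) = k := ⟨⟨k, hkd⟩, rfl⟩
  have hk' : k ∈ grpK n := hk
  have heq : l₁ * k = l₂ * v := by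
    apply Subtype.ext
    rw [Matrix.SpecialLinearGroup.coe_mul, Matrix.SpecialLinearGroup.coe_mul, ← h₁, h₂]
  have hm : l₁⁻¹ * l₂ ∈ grpL n := by
    have h := hl₁.inv.mul hl₂
    rw [← sl_coe_inv, ← Matrix.SpecialLinearGroup.coe_mul] at h
    exact ⟨fun _ _ hij => h.1 hij, h.2⟩
  have hv'' : v⁻¹ ∈ grpU n := by
    have h := hv.inv
    rw [← sl_coe_inv] at h
    exact ⟨fun _ _ hij => h.1 hij, h.2⟩
  refine ⟨l₁, hl₁', k, ⟨hk', l₁⁻¹ * l₂, hm, v, hv', ?_⟩, l₂, hl₂', v⁻¹,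
    ⟨hv'', l₁⁻¹ * l₂, hm, k, hk', ?_⟩, ?_, ?_⟩
  · rw [mul_assoc, ← heq, inv_mul_cancel_left]
  · rw [eq_mul_inv_iff_mul_eq, mul_assoc, ← heq, inv_mul_cancel_left]
  · rw [Matrix.SpecialLinearGroup.coe_mul, ← h₁]
  · rw [inv_inv, Matrix.SpecialLinearGroup.coe_mul, ← h₂]

theorem isDiagonal_of_commute {ev : Fin n → ℂ} (hev : Function.Injective ev) {A : Mat n}
    (h : A * Matrix.diagonal ev = Matrix.diagonal ev * A) :
    A = Matrix.diagonal fun i => A i i := by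
  ext i j
  by_cases hij : i = j
  · subst hij; simp
  · have h1 := congrFun (congrFun h i) j
    rw [Matrix.mul_diagonal, Matrix.diagonal_mul, mul_comm, ← sub_eq_zero, ← sub_mul] at h1
    rw [Matrix.diagonal_apply_ne _ hij]
    exact (mul_eq_zero.1 h1).resolve_left (sub_ne_zero.2 fun h2 => hij (hev h2).symm)

/-- Matrices that conjugate a simple diagonal matrix to the same matrix differ by a diagonal
factor; for matrices with both factorizations this factor is trivial. -/
theorem IsFact.eq_of_conj_eq {ev : Fin n → ℂ} (hev : Function.Injective ev) {g g' : Mat n}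
    (hg : IsFact g) (hg' : IsFact g')
    (h : g⁻¹ * Matrix.diagonal ev * g = g'⁻¹ * Matrix.diagonal ev * g') : g = g' := by
  have h1 := inv_mul_of_det hg.det_ne_zero
  have h2 := mul_inv_of_det hg.det_ne_zero
  have h1' := inv_mul_of_det hg'.det_ne_zero
  have h2' := mul_inv_of_det hg'.det_ne_zero
  have hc : (g' * g⁻¹) * Matrix.diagonal ev = Matrix.diagonal ev * (g' * g⁻¹) := by
    calc (g' * g⁻¹) * Matrix.diagonal ev
        = g' * (g⁻¹ * Matrix.diagonal ev * g) * g⁻¹ := by simp only [mul_assoc, h2, mul_one]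
      _ = Matrix.diagonal ev * (g' * g⁻¹) := by
        rw [h]; simp only [← mul_assoc, h2', one_mul]
  have hd := isDiagonal_of_commute hev hc
  have hgg : g' = (Matrix.diagonal fun i => (g' * g⁻¹) i i) * g := by
    rw [← hd, mul_assoc, h1, mul_one]
  rw [hg.diagonal_eq_one hg' hgg, one_mul] at hgg
  exact hgg.symm

theorem UnitLower.eq_of_mul_unitary {l k l' k' : Mat n} (hl : UnitLower l) (hk : k * kᴴ = 1)
    (hl' : UnitLower l') (hk' : k' * k'ᴴ = 1) (h : l * k = l' * k') : l = l' := by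
  have h1 := elim_gram_lower_mul_unitary hl hk
  rw [h, elim_gram_lower_mul_unitary hl' hk'] at h1
  rw [← Matrix.nonsing_inv_nonsing_inv l (isUnit_iff_ne_zero.2 hl.det_ne_zero), ← h1,
    Matrix.nonsing_inv_nonsing_inv l' (isUnit_iff_ne_zero.2 hl'.det_ne_zero)]

theorem UnitLower.eq_of_mul_posUpper {l v l' v' : Mat n} (hl : UnitLower l) (hv : PosUpper v)
    (hl' : UnitLower l') (hv' : PosUpper v') (h : l * v = l' * v') : l = l' := by
  have h1 := elim_lower_mul_posUpper hl hv
  rw [h, elim_lower_mul_posUpper hl' hv'] at h1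
  rw [← Matrix.nonsing_inv_nonsing_inv l (isUnit_iff_ne_zero.2 hl.det_ne_zero), ← h1,
    Matrix.nonsing_inv_nonsing_inv l' (isUnit_iff_ne_zero.2 hl'.det_ne_zero)]

theorem injOn_phiC {ev : Fin n → ℂ} (hev : Function.Injective ev) :
    InjOn (phiC (Matrix.diagonal ev)) (setC n ×ˢ grpL n) := by
  intro p hp q hq h
  rw [phiC_eq, phiC_eq] at h
  have h1 := (isFact_of_setC hp).eq_of_conj_eq hev (isFact_of_setC hq) h
  have h2 : p.2 = q.2 := by
    apply Subtype.ext
    rw [Matrix.SpecialLinearGroup.coe_mul, Matrix.SpecialLinearGroup.coe_mul] at h1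
    exact (unitLower_of_mem hp.2).eq_of_mul_unitary hp.1.1 (unitLower_of_mem hq.2) hq.1.1 h1
  have h3 : p.2 * p.1 = q.2 * q.1 := Subtype.ext h1
  rw [h2] at h3
  exact Prod.ext (mul_left_cancel h3) h2

theorem injOn_phiD {ev : Fin n → ℂ} (hev : Function.Injective ev) :
    InjOn (phiD (Matrix.diagonal ev)) (setD n ×ˢ grpL n) := by
  intro p hp q hq h
  rw [phiD_eq, phiD_eq] at h
  have h1 := (isFact_of_setD hp).eq_of_conj_eq hev (isFact_of_setD hq) h
  have h2 : p.2 = q.2 := by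
    apply Subtype.ext
    rw [Matrix.SpecialLinearGroup.coe_mul, Matrix.SpecialLinearGroup.coe_mul, sl_coe_inv,
      sl_coe_inv] at h1
    exact (unitLower_of_mem hp.2).eq_of_mul_posUpper (posUpper_of_mem hp.1.1).inv
      (unitLower_of_mem hq.2) (posUpper_of_mem hq.1.1).inv h1
  have h3 : p.2 * p.1⁻¹ = q.2 * q.1⁻¹ := Subtype.ext h1
  rw [h2] at h3
  exact Prod.ext (inv_injective (mul_left_cancel h3)) h2

theorem mem_chartDomain_iff {Λ X : Mat n} :
    X ∈ chartDomain Λ ↔ ∃ g, IsFact g ∧ X = g⁻¹ * Λ * g := by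
  constructor
  · rintro ⟨p, hp, rfl⟩
    exact ⟨_, isFact_of_setC hp, phiC_eq Λ p⟩
  · rintro ⟨g, hg, rfl⟩
    obtain ⟨l₁, hl₁, k, hk, -, -, -, -, h, -⟩ := hg.exists_sl
    exact ⟨(k, l₁), ⟨hk, hl₁⟩, by rw [phiC_eq]; dsimp only; rw [h]⟩

theorem image_phiD_eq (Λ : Mat n) : phiD Λ '' (setD n ×ˢ grpL n) = chartDomain Λ := by
  ext X
  rw [mem_chartDomain_iff]
  constructor
  · rintro ⟨p, hp, rfl⟩
    exact ⟨_, isFact_of_setD hp, phiD_eq Λ p⟩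
  · rintro ⟨g, hg, rfl⟩
    obtain ⟨-, -, -, -, l₂, hl₂, u, hu, -, h⟩ := hg.exists_sl
    exact ⟨(u, l₂), ⟨hu, hl₂⟩, by rw [phiD_eq]; dsimp only; rw [h]⟩

/-! ### The chart and its inverse -/

/-- The value of the chart in terms of the factors; injectivity of the parametrizations makes the
choice in the definition of `chart` irrelevant. -/
theorem chart_eq_of_factors {ev : Fin n → ℂ} (hev : Function.Injective ev)
    {l₁ k l₂ v : Mat n} (hl₁ : UnitLower l₁) (hk : k * kᴴ = 1) (hl₂ : UnitLower l₂)
    (hv : PosUpper v) (h : l₁ * k = l₂ * v) :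
    chart (Matrix.diagonal ev) ((l₂ * v)⁻¹ * Matrix.diagonal ev * (l₂ * v)) =
      (l₁⁻¹ * Matrix.diagonal ev * l₁, l₂⁻¹ * Matrix.diagonal ev * l₂) := by
  have hg : IsFact (l₂ * v) := ⟨⟨l₁, k, hl₁, hk, h.symm⟩, l₂, v, hl₂, hv, rfl⟩
  obtain ⟨m₁, hm₁, c, hc, m₂, hm₂, u, hu, h1, h2⟩ := hg.exists_sl
  have e1 : (m₁ : Mat n) = l₁ := by
    refine (unitLower_of_mem hm₁).eq_of_mul_unitary hc.1 hl₁ hk ?_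
    rw [h, ← h1, Matrix.SpecialLinearGroup.coe_mul]
  have e2 : (m₂ : Mat n) = l₂ := by
    refine (unitLower_of_mem hm₂).eq_of_mul_posUpper (posUpper_of_mem hu.1).inv hl₂ hv ?_
    rw [← h2, Matrix.SpecialLinearGroup.coe_mul, sl_coe_inv]
  have i1 := (injOn_phiC hev).leftInvOn_invFunOn (show (c, m₁) ∈ setC n ×ˢ grpL n from ⟨hc, hm₁⟩)
  have i2 := (injOn_phiD hev).leftInvOn_invFunOn (show (u, m₂) ∈ setD n ×ˢ grpL n from ⟨hu, hm₂⟩)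
  rw [phiC_eq] at i1
  rw [phiD_eq] at i2
  dsimp only at i1 i2
  rw [h1] at i1
  rw [h2] at i2
  rw [chart, i1, i2, phiC_eq, phiD_eq]
  simp [e1, e2]

/-- The `(Y, Z)` variables of `g⁻¹ * Λ * g` as a function of `g`. -/
noncomputable def chartVal (Λ g : Mat n) : Mat n × Mat n :=
  (elim (g * gᴴ) * Λ * (elim (g * gᴴ))⁻¹, elim g * Λ * (elim g)⁻¹)

theorem inv_inv_of_unitLower {l : Mat n} (hl : UnitLower l) : l⁻¹⁻¹ = l :=
  Matrix.nonsing_inv_nonsing_inv l (isUnit_iff_ne_zero.2 hl.det_ne_zero)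

theorem chart_eq_chartVal {ev : Fin n → ℂ} (hev : Function.Injective ev) {g : Mat n}
    (hg : IsFact g) : chart (Matrix.diagonal ev) (g⁻¹ * Matrix.diagonal ev * g) =
      chartVal (Matrix.diagonal ev) g := by
  obtain ⟨⟨l₁, k, hl₁, hk, h₁⟩, l₂, v, hl₂, hv, h₂⟩ := hg
  have e1 : elim (g * gᴴ) = l₁⁻¹ := by rw [h₁]; exact elim_gram_lower_mul_unitary hl₁ hk
  have e2 : elim g = l₂⁻¹ := by rw [h₂]; exact elim_lower_mul_posUpper hl₂ hv
  rw [chartVal, e1, e2, inv_inv_of_unitLower hl₁, inv_inv_of_unitLower hl₂, h₂]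
  exact chart_eq_of_factors hev hl₁ hk hl₂ hv (h₁.symm.trans h₂)

theorem mem_affineLower_iff {ev : Fin n → ℂ} {W : Mat n} :
    W ∈ affineLower (Matrix.diagonal ev) ↔ W.IsLowerTriangular ∧ ∀ i, W i i = ev i := by
  constructor
  · intro h
    refine ⟨fun i j hij => ?_, fun i => ?_⟩
    · have hij' : i < j := hij
      have := h i j hij'.le
      rwa [Matrix.sub_apply, Matrix.diagonal_apply_ne _ hij'.ne, sub_zero] at this
    · have := h i i le_rfl
      rwa [Matrix.sub_apply, Matrix.diagonal_apply_eq, sub_eq_zero] at this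
  · rintro ⟨h1, h2⟩ i j hij
    rw [Matrix.sub_apply]
    rcases hij.lt_or_eq with hij | rfl
    · rw [Matrix.diagonal_apply_ne _ hij.ne, sub_zero]
      exact h1 hij
    · rw [Matrix.diagonal_apply_eq, h2, sub_self]

theorem lower_conj_mem_affineLower {ev : Fin n → ℂ} {l : Mat n} (hl : UnitLower l) :
    l⁻¹ * Matrix.diagonal ev * l ∈ affineLower (Matrix.diagonal ev) :=
  mem_affineLower_iff.2 (diag_mul_lower_mul ev hl hl.inv)

/-- The matrix `g` with both factorizations whose unit lower triangular factors are `l₁` and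
`l₂`. The QR factorization of `l₁⁻¹ * l₂` provides the other factors. -/
noncomputable def factOf (l₁ l₂ : Mat n) : Mat n :=
  l₂ * cholInv ((l₁⁻¹ * l₂)ᴴ * (l₁⁻¹ * l₂))

theorem factOf_spec {l₁ l₂ : Mat n} (hl₁ : UnitLower l₁) (hl₂ : UnitLower l₂) :
    ∃ k v, k * kᴴ = 1 ∧ PosUpper v ∧ l₁ * k = l₂ * v ∧ factOf l₁ l₂ = l₂ * v := by
  have hm := (hl₁.inv.mul hl₂).det_ne_zero
  refine ⟨_, _, mul_cholInv_unitary hm, cholInv_posUpper (gram_posDef hm), ?_, rfl⟩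
  rw [mul_assoc, ← mul_assoc l₁, mul_inv_of_det hl₁.det_ne_zero, one_mul]

theorem factOf_eq {l₁ k l₂ v : Mat n} (hl₁ : UnitLower l₁) (hk : k * kᴴ = 1)
    (hv : PosUpper v) (h : l₁ * k = l₂ * v) : factOf l₁ l₂ = l₂ * v := by
  have hm : l₁⁻¹ * l₂ = k * v⁻¹ := by
    calc l₁⁻¹ * l₂ = l₁⁻¹ * (l₂ * v) * v⁻¹ := by
          simp only [mul_assoc, mul_inv_of_det hv.det_pos.ne', mul_one]
      _ = k * v⁻¹ := by rw [← h, ← mul_assoc, inv_mul_of_det hl₁.det_ne_zero, one_mul]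
  rw [factOf, cholInv_gram hk hv.inv hm,
    Matrix.nonsing_inv_nonsing_inv v (isUnit_iff_ne_zero.2 hv.det_pos.ne')]

/-- The inverse of the `(Y, Z)` variables. -/
noncomputable def chartInv (ev : Fin n → ℂ) (p : Mat n × Mat n) : Mat n :=
  (factOf (eigenRows ev 1 p.1) (eigenRows ev 1 p.2))⁻¹ * Matrix.diagonal ev *
    factOf (eigenRows ev 1 p.1) (eigenRows ev 1 p.2)

theorem conj_eq_of_semiconj {ev : Fin n → ℂ} {l Y : Mat n} (hl : UnitLower l)
    (h : l * Y = Matrix.diagonal ev * l) : l⁻¹ * Matrix.diagonal ev * l = Y := by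
  rw [mul_assoc, ← h, ← mul_assoc, inv_mul_of_det hl.det_ne_zero, one_mul]

theorem chartInv_mem {ev : Fin n → ℂ} (hev : Function.Injective ev) {p : Mat n × Mat n}
    (hp : p ∈ affineLower (Matrix.diagonal ev) ×ˢ affineLower (Matrix.diagonal ev)) :
    chartInv ev p ∈ chartDomain (Matrix.diagonal ev) ∧
      chart (Matrix.diagonal ev) (chartInv ev p) = p := by
  obtain ⟨hY, hYd⟩ := mem_affineLower_iff.1 hp.1
  obtain ⟨hZ, hZd⟩ := mem_affineLower_iff.1 hp.2
  have hl₁ := eigenRows_unitLower hev hY hYd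
  have hl₂ := eigenRows_unitLower hev hZ hZd
  obtain ⟨k, v, hk, hv, h, hf⟩ := factOf_spec hl₁ hl₂
  rw [chartInv, hf]
  refine ⟨mem_chartDomain_iff.2 ⟨_, ⟨⟨_, k, hl₁, hk, h.symm⟩, _, v, hl₂, hv, rfl⟩, rfl⟩, ?_⟩
  rw [chart_eq_of_factors hev hl₁ hk hl₂ hv h,
    conj_eq_of_semiconj hl₁ (eigenRows_mul hY hYd), conj_eq_of_semiconj hl₂ (eigenRows_mul hZ hZd)]

theorem eigenRows_conj {ev : Fin n → ℂ} (hev : Function.Injective ev) {l : Mat n}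
    (hl : UnitLower l) : eigenRows ev 1 (l⁻¹ * Matrix.diagonal ev * l) = l := by
  refine eigenRows_one_lower hev hl ?_
  rw [← mul_assoc, ← mul_assoc, mul_inv_of_det hl.det_ne_zero, one_mul]

theorem chart_mem {ev : Fin n → ℂ} (hev : Function.Injective ev) {X : Mat n}
    (hX : X ∈ chartDomain (Matrix.diagonal ev)) :
    chart (Matrix.diagonal ev) X ∈
        affineLower (Matrix.diagonal ev) ×ˢ affineLower (Matrix.diagonal ev) ∧
      chartInv ev (chart (Matrix.diagonal ev) X) = X := by
  obtain ⟨g, ⟨⟨l₁, k, hl₁, hk, h₁⟩, l₂, v, hl₂, hv, h₂⟩, rfl⟩ := mem_chartDomain_iff.1 hX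
  have h := h₁.symm.trans h₂
  rw [h₂, chart_eq_of_factors hev hl₁ hk hl₂ hv h]
  refine ⟨⟨lower_conj_mem_affineLower hl₁, lower_conj_mem_affineLower hl₂⟩, ?_⟩
  rw [chartInv]
  dsimp only
  rw [eigenRows_conj hev hl₁, eigenRows_conj hev hl₂, factOf_eq hl₁ hk hv h]

/-! ### Analyticity of the chart and openness of its domain -/

theorem analyticAt_chartInv {ev : Fin n → ℂ} (hev : Function.Injective ev) {p : Mat n × Mat n}
    (hp : p ∈ affineLower (Matrix.diagonal ev) ×ˢ affineLower (Matrix.diagonal ev)) :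
    AnalyticAt ℝ (chartInv ev) p := by
  obtain ⟨hY, hYd⟩ := mem_affineLower_iff.1 hp.1
  obtain ⟨hZ, hZd⟩ := mem_affineLower_iff.1 hp.2
  have hl₁ := eigenRows_unitLower hev hY hYd
  have hl₂ := eigenRows_unitLower hev hZ hZd
  have a1 : MatAnalyticAt (fun q : Mat n × Mat n => eigenRows ev 1 q.1) p :=
    (matAnalyticAt_iff.2 analyticAt_fst).eigenRows ev 1
  have a2 : MatAnalyticAt (fun q : Mat n × Mat n => eigenRows ev 1 q.2) p :=
    (matAnalyticAt_iff.2 analyticAt_snd).eigenRows ev 1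
  have a3 := (a1.inv hl₁.det_ne_zero).mul a2
  have a4 := a2.mul ((a3.conjTranspose.mul a3).cholInv
    (gram_posDef (hl₁.inv.mul hl₂).det_ne_zero))
  obtain ⟨k, v, hk, hv, h, hf⟩ := factOf_spec hl₁ hl₂
  have hdet : (factOf (eigenRows ev 1 p.1) (eigenRows ev 1 p.2)).det ≠ 0 := by
    rw [hf, Matrix.det_mul]
    exact mul_ne_zero hl₂.det_ne_zero hv.det_pos.ne'
  exact matAnalyticAt_iff.1 (((a4.inv hdet).mul (MatAnalyticAt.const _)).mul a4)

/-- The matrices `X` for which the matrix of left eigenvectors that continues `g₀` is invertible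
and has an LU factorization. -/
def eigenNhd (ev : Fin n → ℂ) (g₀ : Mat n) : Set (Mat n) :=
  {X | HasMinors (eigenRows ev g₀ X) ∧ (eigenRows ev g₀ X).det ≠ 0}

theorem matAnalyticAt_eigenRows (ev : Fin n → ℂ) (g₀ X : Mat n) :
    MatAnalyticAt (fun Y => eigenRows ev g₀ Y) X :=
  MatAnalyticAt.eigenRows (f := fun Y => Y) (matAnalyticAt_iff.2 analyticAt_id) ev g₀

theorem isOpen_eigenNhd (ev : Fin n → ℂ) (g₀ : Mat n) : IsOpen (eigenNhd ev g₀) := by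
  have h1 : Continuous fun X => (eigenRows ev g₀ X).det :=
    continuous_iff_continuousAt.2 fun X => (matAnalyticAt_eigenRows ev g₀ X).det.continuousAt
  have h2 : ∀ i, Continuous fun X => (leadingBlock i (eigenRows ev g₀ X)).det := fun i =>
    continuous_iff_continuousAt.2 fun X =>
      ((matAnalyticAt_eigenRows ev g₀ X).leadingBlock i).det.continuousAt
  have h3 : eigenNhd ev g₀ = (⋂ i, {X | (leadingBlock i (eigenRows ev g₀ X)).det ≠ 0}) ∩
      {X | (eigenRows ev g₀ X).det ≠ 0} := by
    ext X
    simp [eigenNhd, HasMinors]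
  rw [h3]
  exact (isOpen_iInter_of_finite fun i => isOpen_ne_fun (h2 i) continuous_const).inter
    (isOpen_ne_fun h1 continuous_const)

theorem mul_conj_eq {Λ g : Mat n} (hg : g.det ≠ 0) : g * (g⁻¹ * Λ * g) = Λ * g := by
  rw [← mul_assoc, ← mul_assoc, mul_inv_of_det hg, one_mul]

theorem mem_eigenNhd {ev : Fin n → ℂ} (hev : Function.Injective ev) {g : Mat n} (hg : IsFact g) :
    g⁻¹ * Matrix.diagonal ev * g ∈ eigenNhd ev g := by
  have h := eigenRows_self hev hg.det_ne_zero (mul_conj_eq (Λ := Matrix.diagonal ev) hg.det_ne_zero)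
  rw [eigenNhd, mem_ofPred_eq, h]
  exact ⟨hg.hasMinors, hg.det_ne_zero⟩

/-- Every matrix of the conjugacy class that lies in the neighbourhood `eigenNhd` is in the chart
domain, since `eigenRows` can be normalized there. -/
theorem mem_chartDomain_of_mem_eigenNhd {ev : Fin n → ℂ} (hev : Function.Injective ev)
    {g₀ h : Mat n} (hh : h.det ≠ 0)
    (hX : h⁻¹ * Matrix.diagonal ev * h ∈ eigenNhd ev g₀) :
    h⁻¹ * Matrix.diagonal ev * h ∈ chartDomain (Matrix.diagonal ev) := by
  obtain ⟨hm, hdet⟩ := hX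
  have hG := eigenRows_eq hev g₀ hh (mul_conj_eq (Λ := Matrix.diagonal ev) hh)
  have hn := normalize_isFact hm hdet
  set G := eigenRows ev g₀ (h⁻¹ * Matrix.diagonal ev * h)
  refine mem_chartDomain_iff.2 ⟨normalize G, hn, ?_⟩
  have hN : normalize G * (h⁻¹ * Matrix.diagonal ev * h) = Matrix.diagonal ev * normalize G := by
    have hn1 : normalize G = Matrix.diagonal (fun i => normDiag G i * (g₀ * h⁻¹) i i) * h := by
      rw [← Matrix.diagonal_mul_diagonal, mul_assoc, ← hG]; rfl
    rw [hn1, mul_assoc, mul_conj_eq hh, ← mul_assoc, ← mul_assoc, Matrix.diagonal_mul_diagonal,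
      Matrix.diagonal_mul_diagonal]
    simp only [mul_comm]
  rw [mul_assoc (normalize G)⁻¹, ← hN, ← mul_assoc, inv_mul_of_det hn.det_ne_zero, one_mul]

theorem analyticWithinAt_chart {ev : Fin n → ℂ} (hev : Function.Injective ev) {X : Mat n}
    (hX : X ∈ chartDomain (Matrix.diagonal ev)) :
    AnalyticWithinAt ℝ (chart (Matrix.diagonal ev)) (chartDomain (Matrix.diagonal ev)) X := by
  obtain ⟨g₀, hg₀, rfl⟩ := mem_chartDomain_iff.1 hX
  have hmem := mem_eigenNhd hev hg₀
  -- Near `g₀⁻¹ * Λ * g₀` the chart agrees with an analytic function of an ambient neighbourhood.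
  have key : ∀ Y ∈ chartDomain (Matrix.diagonal ev) ∩ eigenNhd ev g₀,
      chart (Matrix.diagonal ev) Y =
        chartVal (Matrix.diagonal ev) (normalize (eigenRows ev g₀ Y)) := by
    rintro Y ⟨hY, hm, hdet⟩
    obtain ⟨g, hg, rfl⟩ := mem_chartDomain_iff.1 hY
    rw [chart_eq_chartVal hev hg, normalize_diagonal_mul hg (eigenRows_eq hev g₀ hg.det_ne_zero
      (mul_conj_eq (Λ := Matrix.diagonal ev) hg.det_ne_zero)) hm hdet]
  have a1 := (matAnalyticAt_eigenRows ev g₀ (g₀⁻¹ * Matrix.diagonal ev * g₀)).normalize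
    hmem.1 hmem.2
  have hn := normalize_isFact hmem.1 hmem.2
  have a2 := (a1.mul a1.conjTranspose).elim (hasMinors_of_posDef (gram_posDef' hn.det_ne_zero))
  have a3 := a1.elim hn.hasMinors
  have a4 := (a2.mul (MatAnalyticAt.const (Matrix.diagonal ev))).mul
    (a2.inv (elim_unitLower _).det_ne_zero)
  have a5 := (a3.mul (MatAnalyticAt.const (Matrix.diagonal ev))).mul
    (a3.inv (elim_unitLower _).det_ne_zero)
  have a6 : AnalyticAt ℝ
      (fun Y => chartVal (Matrix.diagonal ev) (normalize (eigenRows ev g₀ Y)))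
      (g₀⁻¹ * Matrix.diagonal ev * g₀) :=
    (matAnalyticAt_iff.1 a4).prod (matAnalyticAt_iff.1 a5)
  refine a6.analyticWithinAt.congr_of_eventuallyEq ?_ (key _ ⟨hX, hmem⟩)
  filter_upwards [self_mem_nhdsWithin,
    mem_nhdsWithin_of_mem_nhds ((isOpen_eigenNhd ev g₀).mem_nhds hmem)] with Y h1 h2
  exact key Y ⟨h1, h2⟩

theorem mem_conjClass_iff {X₀ Λ X : Mat n} (hΛ : Λ ∈ conjClass X₀) :
    X ∈ conjClass X₀ ↔ ∃ h : SL n, X = (h : Mat n)⁻¹ * Λ * (h : Mat n) := by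
  obtain ⟨a, rfl⟩ := hΛ
  have hmul : ∀ g h : SL n, conj g (conj h X₀) = conj (g * h) X₀ := by
    intro g h
    simp only [conj, _root_.mul_inv_rev, Matrix.SpecialLinearGroup.coe_mul, mul_assoc]
  constructor
  · rintro ⟨b, rfl⟩
    refine ⟨a * b⁻¹, ?_⟩
    dsimp only
    rw [← conj_inv_eq, hmul]
    congr 1
    group
  · rintro ⟨h, rfl⟩
    rw [← conj_inv_eq]
    dsimp only
    rw [hmul]
    exact ⟨_, rfl⟩

theorem exists_isOpen_chartDomain {ev : Fin n → ℂ} (hev : Function.Injective ev) {X₀ : Mat n}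
    (hΛ : Matrix.diagonal ev ∈ conjClass X₀) :
    ∃ V : Set (Mat n), IsOpen V ∧ chartDomain (Matrix.diagonal ev) = conjClass X₀ ∩ V := by
  refine ⟨⋃ g₀ ∈ {g : Mat n | IsFact g}, eigenNhd ev g₀,
    isOpen_biUnion fun g₀ _ => isOpen_eigenNhd ev g₀, ?_⟩
  ext X
  constructor
  · intro hX
    obtain ⟨g, hg, rfl⟩ := mem_chartDomain_iff.1 hX
    exact ⟨(mem_conjClass_iff hΛ).2 ⟨⟨g, hg.det⟩, rfl⟩,
      mem_iUnion₂.2 ⟨g, hg, mem_eigenNhd hev hg⟩⟩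
  · rintro ⟨hX, hV⟩
    obtain ⟨h, rfl⟩ := (mem_conjClass_iff hΛ).1 hX
    obtain ⟨g₀, -, hm⟩ := mem_iUnion₂.1 hV
    exact mem_chartDomain_of_mem_eigenNhd hev (sl_det_ne_zero h) hm

theorem injective_of_hasSimpleSpectrum {X₀ : Mat n} (hsimple : HasSimpleSpectrum X₀)
    {ev : Fin n → ℂ} (hΛ : Matrix.diagonal ev ∈ conjClass X₀) : Function.Injective ev := by
  obtain ⟨a, ha⟩ := hΛ
  have hsc : (a : Mat n) * X₀ = Matrix.diagonal ev * (a : Mat n) := by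
    rw [← ha]
    simp only [conj, mul_assoc]
    rw [sl_coe_inv, inv_mul_of_det (sl_det_ne_zero a), mul_one]
  have hX : (a : Mat n)⁻¹ * (Matrix.diagonal ev * (a : Mat n)) = X₀ := by
    rw [← hsc, ← mul_assoc, inv_mul_of_det (sl_det_ne_zero a), one_mul]
  have hchar : X₀.charpoly = (Matrix.diagonal ev).charpoly := by
    rw [← hX, Matrix.charpoly_mul_comm, mul_assoc, mul_inv_of_det (sl_det_ne_zero a), mul_one]
  have h1 : (Matrix.diagonal ev).charpoly.roots = Finset.univ.val.map ev := by
    rw [Matrix.charpoly_of_isUpperTriangular _ (blockTriangular_diagonal _)]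
    simp only [Matrix.diagonal_apply_eq]
    have h2 := Polynomial.roots_multiset_prod_X_sub_C (Finset.univ.val.map ev)
    rw [Multiset.map_map] at h2
    exact h2
  unfold HasSimpleSpectrum at hsimple
  rw [hchar, h1] at hsimple
  intro i j hij
  exact Multiset.inj_on_of_nodup_map hsimple i (Finset.mem_univ i) j (Finset.mem_univ j) hij

/-! ### The linear vector field and its flow -/

theorem linField_fst (ev : Fin n → ℂ) (p : Mat n × Mat n) (j k : Fin n) :
    (linField (Matrix.diagonal ev) p).1 j k = Complex.I * ((ev k - ev j).im : ℂ) * p.1 j k := by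
  have h : imMat (Matrix.diagonal ev) = Matrix.diagonal fun i => ((ev i).im : ℂ) := by
    rw [imMat, Matrix.diagonal_map (by simp)]
  change ⁅p.1, Complex.I • imMat (Matrix.diagonal ev)⁆ j k = _
  rw [h, Ring.lie_def, mul_smul_comm, smul_mul_assoc, Matrix.sub_apply, Matrix.smul_apply,
    Matrix.smul_apply, Matrix.mul_diagonal, Matrix.diagonal_mul, Complex.sub_im]
  push_cast
  simp only [smul_eq_mul]
  ring

theorem linField_snd (ev : Fin n → ℂ) (p : Mat n × Mat n) (j k : Fin n) :
    (linField (Matrix.diagonal ev) p).2 j k = ((ev j - ev k).re : ℂ) * p.2 j k := by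
  have h : reMat (Matrix.diagonal ev) = Matrix.diagonal fun i => ((ev i).re : ℂ) := by
    rw [reMat, Matrix.diagonal_map (by simp)]
  change ⁅p.2, -reMat (Matrix.diagonal ev)⁆ j k = _
  rw [h, Ring.lie_def, mul_neg, neg_mul, Matrix.sub_apply, Matrix.neg_apply, Matrix.neg_apply,
    Matrix.mul_diagonal, Matrix.diagonal_mul, Complex.sub_re]
  push_cast
  ring

theorem linField_mem {ev : Fin n → ℂ} {p : Mat n × Mat n}
    (hp : p ∈ affineLower (Matrix.diagonal ev) ×ˢ affineLower (Matrix.diagonal ev)) :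
    (linField (Matrix.diagonal ev) p).1 ∈ strictLower n ∧
      (linField (Matrix.diagonal ev) p).2 ∈ strictLower n := by
  obtain ⟨hY, -⟩ := mem_affineLower_iff.1 hp.1
  obtain ⟨hZ, -⟩ := mem_affineLower_iff.1 hp.2
  constructor
  · intro i j hij
    rw [linField_fst]
    rcases hij.lt_or_eq with h | rfl
    · rw [hY h, mul_zero]
    · simp
  · intro i j hij
    rw [linField_snd]
    rcases hij.lt_or_eq with h | rfl
    · rw [hZ h, mul_zero]
    · simp

/-- The flow of the linear vector field. -/
noncomputable def linFlow (ev : Fin n → ℂ) (p : Mat n × Mat n) (t : ℝ) : Mat n × Mat n :=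
  (Matrix.of fun j k => Complex.exp (t * (Complex.I * ((ev k - ev j).im : ℂ))) * p.1 j k,
   Matrix.of fun j k => Complex.exp (t * ((ev j - ev k).re : ℂ)) * p.2 j k)

theorem hasDerivAt_mat_iff {f : ℝ → Mat n} {f' : Mat n} {t : ℝ} :
    HasDerivAt f f' t ↔ ∀ i j, HasDerivAt (fun s => f s i j) (f' i j) t := by
  constructor
  · intro h i j
    have h1 : HasDerivAt (fun s => f s i) (f' i) t := hasDerivAt_pi.1 h i
    exact hasDerivAt_pi.1 h1 j
  · intro h
    have h1 : ∀ i, HasDerivAt (fun s => f s i) (f' i) t := fun i => hasDerivAt_pi.2 (h i)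
    exact hasDerivAt_pi.2 h1

theorem hasDerivAt_cexp_mul (a : ℂ) (t : ℝ) :
    HasDerivAt (fun s : ℝ => Complex.exp (s * a)) (a * Complex.exp (t * a)) t := by
  have h1 : HasDerivAt (fun s : ℝ => (s : ℂ) * a) (1 * a) t :=
    (Complex.ofRealCLM.hasDerivAt (x := t)).mul_const a
  have h2 := h1.cexp
  rwa [one_mul, mul_comm] at h2

theorem hasDerivAt_linFlow (ev : Fin n → ℂ) (p : Mat n × Mat n) (t : ℝ) :
    HasDerivAt (linFlow ev p) (linField (Matrix.diagonal ev) (linFlow ev p t)) t := by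
  have h1 : HasDerivAt (fun s => (linFlow ev p s).1)
      (linField (Matrix.diagonal ev) (linFlow ev p t)).1 t := by
    refine hasDerivAt_mat_iff.2 fun i j => ?_
    rw [linField_fst]
    have h := (hasDerivAt_cexp_mul (Complex.I * ((ev j - ev i).im : ℂ)) t).mul_const (p.1 i j)
    rw [mul_assoc] at h
    exact h
  have h2 : HasDerivAt (fun s => (linFlow ev p s).2)
      (linField (Matrix.diagonal ev) (linFlow ev p t)).2 t := by
    refine hasDerivAt_mat_iff.2 fun i j => ?_
    rw [linField_snd]
    have h := (hasDerivAt_cexp_mul ((ev i - ev j).re : ℂ) t).mul_const (p.2 i j)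
    rw [mul_assoc] at h
    exact h
  exact h1.prodMk h2

theorem linFlow_zero (ev : Fin n → ℂ) (p : Mat n × Mat n) : linFlow ev p 0 = p := by
  refine Prod.ext ?_ ?_ <;> ext i j <;> simp [linFlow]

theorem linFlow_mem {ev : Fin n → ℂ} {p : Mat n × Mat n}
    (hp : p ∈ affineLower (Matrix.diagonal ev) ×ˢ affineLower (Matrix.diagonal ev)) (t : ℝ) :
    linFlow ev p t ∈ affineLower (Matrix.diagonal ev) ×ˢ affineLower (Matrix.diagonal ev) := by
  obtain ⟨hY, hYd⟩ := mem_affineLower_iff.1 hp.1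
  obtain ⟨hZ, hZd⟩ := mem_affineLower_iff.1 hp.2
  refine ⟨mem_affineLower_iff.2 ⟨fun i j h => ?_, fun i => ?_⟩,
    mem_affineLower_iff.2 ⟨fun i j h => ?_, fun i => ?_⟩⟩
  · simp only [linFlow, Matrix.of_apply, hY h, mul_zero]
  · simp [linFlow, hYd]
  · simp only [linFlow, Matrix.of_apply, hZ h, mul_zero]
  · simp [linFlow, hZd]

theorem eq_cexp_mul_of_hasDerivAt {f : ℝ → ℂ} {a : ℂ} (h : ∀ t, HasDerivAt f (a * f t) t)
    (t : ℝ) : f t = Complex.exp (t * a) * f 0 := by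
  have h1 : ∀ s : ℝ, HasDerivAt (fun s : ℝ => Complex.exp (s * (-a)) * f s) 0 s := by
    intro s
    have h2 := (hasDerivAt_cexp_mul (-a) s).mul (h s)
    exact h2.congr_deriv (by ring)
  have h3 := is_const_of_deriv_eq_zero (fun s => (h1 s).differentiableAt)
    (fun s => (h1 s).deriv) t 0
  simp only [Complex.ofReal_zero, zero_mul, Complex.exp_zero, one_mul] at h3
  rw [← h3, ← mul_assoc, ← Complex.exp_add]
  simp

theorem IsTrajectory.eq_linFlow {ev : Fin n → ℂ} {S : Set (Mat n × Mat n)}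
    {γ : ℝ → Mat n × Mat n} (h : IsTrajectory (linField (Matrix.diagonal ev)) S γ) (t : ℝ) :
    γ t = linFlow ev (γ 0) t := by
  have hd := fun s => (h s).2
  have h1 : ∀ s, HasDerivAt (fun s => (γ s).1) (linField (Matrix.diagonal ev) (γ s)).1 s :=
    fun s => (ContinuousLinearMap.fst ℝ (Mat n) (Mat n)).hasFDerivAt.comp_hasDerivAt s (hd s)
  have h2 : ∀ s, HasDerivAt (fun s => (γ s).2) (linField (Matrix.diagonal ev) (γ s)).2 s :=
    fun s => (ContinuousLinearMap.snd ℝ (Mat n) (Mat n)).hasFDerivAt.comp_hasDerivAt s (hd s)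
  refine Prod.ext ?_ ?_ <;> ext i j
  · refine eq_cexp_mul_of_hasDerivAt (f := fun s => (γ s).1 i j) (fun s => ?_) t
    have := hasDerivAt_mat_iff.1 (h1 s) i j
    rwa [linField_fst] at this
  · refine eq_cexp_mul_of_hasDerivAt (f := fun s => (γ s).2 i j) (fun s => ?_) t
    have := hasDerivAt_mat_iff.1 (h2 s) i j
    rwa [linField_snd] at this

theorem existsUnique_trajectory {ev : Fin n → ℂ} {p : Mat n × Mat n}
    (hp : p ∈ affineLower (Matrix.diagonal ev) ×ˢ affineLower (Matrix.diagonal ev)) :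
    ∃! γ : ℝ → Mat n × Mat n, IsTrajectory (linField (Matrix.diagonal ev))
      (affineLower (Matrix.diagonal ev) ×ˢ affineLower (Matrix.diagonal ev)) γ ∧ γ 0 = p := by
  refine ⟨linFlow ev p, ⟨fun t => ⟨linFlow_mem hp t, hasDerivAt_linFlow ev p t⟩,
    linFlow_zero ev p⟩, ?_⟩
  rintro γ ⟨hγ, h0⟩
  funext t
  rw [hγ.eq_linFlow t, h0]

theorem isCompact_closure_linFlow_fst (ev : Fin n → ℂ) (p : Mat n × Mat n) :
    IsCompact (closure (Set.range fun t => (linFlow ev p t).1)) := by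
  have : ProperSpace (Mat n) := FiniteDimensional.proper ℝ (Mat n)
  refine Bornology.IsBounded.isCompact_closure (isBounded_iff_forall_norm_le.2 ⟨‖p.1‖, ?_⟩)
  rintro _ ⟨t, rfl⟩
  refine (Matrix.norm_le_iff (norm_nonneg _)).2 fun i j => ?_
  have h : ‖Complex.exp (t * (Complex.I * ((ev j - ev i).im : ℂ)))‖ = 1 := by
    rw [Complex.norm_exp]
    simp
  simp only [linFlow, Matrix.of_apply, norm_mul, h, one_mul]
  exact Matrix.norm_entry_le_entrywise_sup_norm p.1

/-- The values `exp (a t) z` are bounded in `t` only if `a = 0` or `z = 0`. -/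
theorem eq_zero_of_bounded_exp {a C : ℝ} {z : ℂ}
    (h : ∀ t : ℝ, ‖Complex.exp (t * (a : ℂ)) * z‖ ≤ C) : a = 0 ∨ z = 0 := by
  by_contra! hne
  obtain ⟨ha, hz⟩ := hne
  have hz' : 0 < ‖z‖ := norm_pos_iff.2 hz
  -- At this time the exponential is `exp (C / ‖z‖)`, which exceeds `C / ‖z‖`.
  have h1 := h (C / ‖z‖ / a)
  have h2 : ‖Complex.exp (((C / ‖z‖ / a : ℝ) : ℂ) * (a : ℂ))‖ = Real.exp (C / ‖z‖) := by
    rw [← Complex.ofReal_mul, div_mul_cancel₀ _ ha, Complex.norm_exp, Complex.ofReal_re]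
  rw [norm_mul, h2, ← le_div_iff₀ hz'] at h1
  linarith [Real.add_one_le_exp (C / ‖z‖)]

theorem isCompact_linFlow_snd_iff (ev : Fin n → ℂ) (p : Mat n × Mat n) :
    IsCompact (Set.range fun t => (linFlow ev p t).2) ↔ ∀ t, (linFlow ev p t).2 = p.2 := by
  constructor
  · intro h t
    obtain ⟨C, hC⟩ := isBounded_iff_forall_norm_le.1 h.isBounded
    ext i j
    have hb : ∀ s : ℝ, ‖Complex.exp (s * ((ev i - ev j).re : ℂ)) * p.2 i j‖ ≤ C := fun s =>
      (Matrix.norm_entry_le_entrywise_sup_norm (linFlow ev p s).2).trans (hC _ ⟨s, rfl⟩)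
    simp only [linFlow, Matrix.of_apply]
    rcases eq_zero_of_bounded_exp hb with h0 | h0
    · rw [h0]
      simp
    · rw [h0, mul_zero]
  · intro h
    simp only [h]
    exact (isCompact_singleton (x := p.2)).of_isClosed_subset
      (by rw [Set.range_const]; exact isClosed_singleton) (by rw [Set.range_const])

/-! ### The Toda flow through a point of the chart domain -/

/-- The projection `piK` splits every sum of a skew-Hermitian matrix and an upper triangular
matrix with real diagonal, whether or not the traces vanish. -/
theorem piK_add {A B : Mat n} (hA : Aᴴ = -A) (hB : B.IsUpperTriangular)
    (hBd : ∀ i, (B i i).im = 0) : piK (A + B) = A := by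
  have hs : ∀ i j, star (A j i) = -A i j := fun i j => congrFun (congrFun hA i) j
  ext i j
  rcases lt_trichotomy i j with h | h | h
  · have h1 := hs i j
    have h2 : B j i = 0 := hB h
    simp only [piK, Matrix.of_apply, h, h.not_gt, if_true, if_false, Matrix.add_apply, h2,
      add_zero, h1, neg_neg]
  · subst h
    have h2 := hBd i
    have h3 : (A i i).re = 0 := by
      have := congrArg Complex.re (hs i i)
      simp at this
      linarith
    apply Complex.ext <;> simp [piK, h2, h3]
  · have h2 : B i j = 0 := hB h
    simp [piK, h, h2]

theorem hasDerivAt_mat_mul {f g : ℝ → Mat n} {f' g' : Mat n} {t : ℝ} (hf : HasDerivAt f f' t)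
    (hg : HasDerivAt g g' t) : HasDerivAt (fun s => f s * g s) (f' * g t + f t * g') t := by
  refine hasDerivAt_mat_iff.2 fun i j => ?_
  simp only [Matrix.mul_apply, Matrix.add_apply, ← Finset.sum_add_distrib]
  exact HasDerivAt.fun_sum fun k _ =>
    (hasDerivAt_mat_iff.1 hf i k).mul (hasDerivAt_mat_iff.1 hg k j)

theorem hasDerivAt_mat_conjTranspose {f : ℝ → Mat n} {f' : Mat n} {t : ℝ}
    (hf : HasDerivAt f f' t) : HasDerivAt (fun s => (f s)ᴴ) f'ᴴ t :=
  hasDerivAt_mat_iff.2 fun i j => (hasDerivAt_mat_iff.1 hf j i).star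

/-- The exponential `exp (t * X)` for `X = g⁻¹ * diagonal ev * g`. -/
noncomputable def expConj (ev : Fin n → ℂ) (g : Mat n) (t : ℝ) : Mat n :=
  g⁻¹ * Matrix.diagonal (fun i => Complex.exp (t * ev i)) * g

theorem hasDerivAt_expConj (ev : Fin n → ℂ) (g : Mat n) :
    HasDerivAt (expConj ev g) (g⁻¹ * Matrix.diagonal ev * g) 0 := by
  have h1 : HasDerivAt (fun t : ℝ => Matrix.diagonal fun i => Complex.exp (t * ev i))
      (Matrix.diagonal ev) 0 := by
    refine hasDerivAt_mat_iff.2 fun i j => ?_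
    by_cases hij : i = j
    · subst hij
      simp only [Matrix.diagonal_apply_eq]
      simpa using hasDerivAt_cexp_mul (ev i) 0
    · simp only [Matrix.diagonal_apply_ne _ hij]
      exact hasDerivAt_const _ _
  have h2 := hasDerivAt_mat_mul (hasDerivAt_mat_mul (hasDerivAt_const (0 : ℝ) g⁻¹) h1)
    (hasDerivAt_const (0 : ℝ) g)
  simp only [zero_mul, zero_add, mul_zero, add_zero] at h2
  exact h2

theorem expConj_zero (ev : Fin n → ℂ) {g : Mat n} (hg : g.det ≠ 0) : expConj ev g 0 = 1 := by
  simp [expConj, inv_mul_of_det hg]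

theorem expConj_det_ne_zero (ev : Fin n → ℂ) {g : Mat n} (hg : g.det ≠ 0) (t : ℝ) :
    (expConj ev g t).det ≠ 0 := by
  rw [expConj, Matrix.det_mul, Matrix.det_mul, Matrix.det_diagonal]
  exact mul_ne_zero (mul_ne_zero (inv_det_ne_zero hg)
    (Finset.prod_ne_zero_iff.2 fun i _ => Complex.exp_ne_zero _)) hg

/-- The upper triangular matrix `v` with `exp (t * X) * v` unitary. -/
noncomputable def todaV (ev : Fin n → ℂ) (g : Mat n) (t : ℝ) : Mat n :=
  cholInv ((expConj ev g t)ᴴ * expConj ev g t)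

/-- The unitary factor of the QR factorization of `exp (t * X)`. -/
noncomputable def todaK (ev : Fin n → ℂ) (g : Mat n) (t : ℝ) : Mat n :=
  expConj ev g t * todaV ev g t

/-- The solution of the Toda equation through `X`: conjugation of `X` by the unitary factor of
`exp (t * X)`. -/
noncomputable def todaFlow (ev : Fin n → ℂ) (g : Mat n) (t : ℝ) : Mat n :=
  (todaK ev g t)ᴴ * (g⁻¹ * Matrix.diagonal ev * g) * todaK ev g t

theorem todaK_unitary (ev : Fin n → ℂ) {g : Mat n} (hg : g.det ≠ 0) (t : ℝ) :
    todaK ev g t * (todaK ev g t)ᴴ = 1 :=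
  mul_cholInv_unitary (expConj_det_ne_zero ev hg t)

theorem todaV_posUpper (ev : Fin n → ℂ) {g : Mat n} (hg : g.det ≠ 0) (t : ℝ) :
    PosUpper (todaV ev g t) :=
  cholInv_posUpper (gram_posDef (expConj_det_ne_zero ev hg t))

theorem todaV_zero (ev : Fin n → ℂ) {g : Mat n} (hg : g.det ≠ 0) : todaV ev g 0 = 1 := by
  rw [todaV, expConj_zero ev hg, Matrix.conjTranspose_one, mul_one, cholInv_one]

theorem todaK_zero (ev : Fin n → ℂ) {g : Mat n} (hg : g.det ≠ 0) : todaK ev g 0 = 1 := by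
  rw [todaK, todaV_zero ev hg, expConj_zero ev hg, mul_one]

theorem todaFlow_zero (ev : Fin n → ℂ) {g : Mat n} (hg : g.det ≠ 0) :
    todaFlow ev g 0 = g⁻¹ * Matrix.diagonal ev * g := by
  rw [todaFlow, todaK_zero ev hg, Matrix.conjTranspose_one, one_mul, mul_one]

theorem exists_hasDerivAt_todaV (ev : Fin n → ℂ) {g : Mat n} (hg : g.det ≠ 0) :
    ∃ W : Mat n, HasDerivAt (todaV ev g) W 0 ∧ W.IsUpperTriangular ∧ ∀ i, (W i i).im = 0 := by
  have hm := hasDerivAt_expConj ev g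
  have h1 := hasDerivAt_mat_mul (hasDerivAt_mat_conjTranspose hm) hm
  have h2 : AnalyticAt ℝ (cholInv : Mat n → Mat n)
      ((expConj ev g 0)ᴴ * expConj ev g 0) :=
    matAnalyticAt_iff.1 (MatAnalyticAt.cholInv (f := fun M => M)
      (matAnalyticAt_iff.2 analyticAt_id) (gram_posDef (expConj_det_ne_zero ev hg 0)))
  have h3 := h2.differentiableAt.hasFDerivAt.comp_hasDerivAt (0 : ℝ) h1
  have h4 := hasDerivAt_mat_iff.1 h3
  refine ⟨_, h3, fun i j hij => ?_, fun i => ?_⟩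
  · refine (h4 i j).unique ((hasDerivAt_const (0 : ℝ) (0 : ℂ)).congr_of_eventuallyEq
      (Filter.Eventually.of_forall fun t => ?_))
    exact (todaV_posUpper ev hg t).1 hij
  · have h5 : HasDerivAt (fun t : ℝ => (todaV ev g t i i).im) _ 0 :=
      Complex.imCLM.hasFDerivAt.comp_hasDerivAt (0 : ℝ) (h4 i i)
    refine h5.unique ((hasDerivAt_const (0 : ℝ) (0 : ℝ)).congr_of_eventuallyEq
      (Filter.Eventually.of_forall fun t => ?_))
    exact (Complex.lt_def.1 ((todaV_posUpper ev hg t).2 i)).2.symm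

/-- The curve `todaFlow` has the Toda vector as its initial velocity: if `k` and `v` are the
factors with `k = exp (t * X) * v`, then `k' = X + v'` at `t = 0`, so `k'` is `piK X`
because it is skew-Hermitian and `v'` is upper triangular with real diagonal. -/
theorem hasDerivAt_todaFlow (ev : Fin n → ℂ) {g : Mat n} (hg : g.det ≠ 0) :
    HasDerivAt (todaFlow ev g) (toda (g⁻¹ * Matrix.diagonal ev * g)) 0 := by
  obtain ⟨W, hW, hWu, hWd⟩ := exists_hasDerivAt_todaV ev hg
  set X := g⁻¹ * Matrix.diagonal ev * g with hX
  have hk : HasDerivAt (todaK ev g) (X + W) 0 := by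
    have h := hasDerivAt_mat_mul (hasDerivAt_expConj ev g) hW
    rw [todaV_zero ev hg, expConj_zero ev hg, one_mul, mul_one] at h
    exact h
  have hkH := hasDerivAt_mat_conjTranspose hk
  have hskew : (X + W)ᴴ = -(X + W) := by
    have h := hasDerivAt_mat_mul hk hkH
    rw [todaK_zero ev hg, Matrix.conjTranspose_one, one_mul, mul_one] at h
    have h0 : HasDerivAt (fun s => todaK ev g s * (todaK ev g s)ᴴ) 0 0 :=
      (hasDerivAt_const (0 : ℝ) (1 : Mat n)).congr_of_eventuallyEq
        (Filter.Eventually.of_forall fun t => todaK_unitary ev hg t)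
    exact eq_neg_of_add_eq_zero_right (h.unique h0)
  have hpi : piK X = X + W := by
    have h := piK_add (A := X + W) (B := -W) hskew hWu.neg (fun i => by simp [hWd])
    rwa [add_neg_cancel_right] at h
  have h := hasDerivAt_mat_mul (hasDerivAt_mat_mul hkH (hasDerivAt_const (0 : ℝ) X)) hk
  rw [todaK_zero ev hg, Matrix.conjTranspose_one, one_mul, mul_one, add_zero, one_mul,
    hskew, ← hpi] at h
  refine h.congr_deriv ?_
  rw [toda, Ring.lie_def, neg_mul, sub_eq_neg_add]

theorem diagonal_conj_inv {d : Fin n → ℂ} (hd : ∀ i, d i ≠ 0) {ev : Fin n → ℂ} {l : Mat n} :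
    (Matrix.diagonal d * l * Matrix.diagonal fun i => (d i)⁻¹)⁻¹ * Matrix.diagonal ev *
      (Matrix.diagonal d * l * Matrix.diagonal fun i => (d i)⁻¹) =
    Matrix.diagonal d * (l⁻¹ * Matrix.diagonal ev * l) * Matrix.diagonal fun i => (d i)⁻¹ := by
  have h1 := diagonal_inv_mul_diagonal hd
  have h2 : (Matrix.diagonal d)⁻¹ = Matrix.diagonal fun i => (d i)⁻¹ := Matrix.inv_eq_left_inv h1
  have h3 : (Matrix.diagonal fun i => (d i)⁻¹)⁻¹ = Matrix.diagonal d := Matrix.inv_eq_right_inv h1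
  have h4 : (Matrix.diagonal fun i => (d i)⁻¹) * (Matrix.diagonal ev * Matrix.diagonal d) =
      Matrix.diagonal ev := by
    rw [Matrix.diagonal_mul_diagonal, Matrix.diagonal_mul_diagonal]
    congr 1
    funext i
    field_simp [hd i]
  rw [Matrix.mul_inv_rev, Matrix.mul_inv_rev, h2, h3]
  calc _ = Matrix.diagonal d * (l⁻¹ * ((Matrix.diagonal fun i => (d i)⁻¹) *
        (Matrix.diagonal ev * Matrix.diagonal d)) * l) * Matrix.diagonal fun i => (d i)⁻¹ := by
        simp only [mul_assoc]
    _ = _ := by rw [h4]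

/-- Write `g = l₁ * k = l₂ * v`. Up to the diagonal unitary matrix `exp (-i t Im Λ)`, the matrix
`g * todaK t = exp (t Λ) * g * todaV t` inherits both factorizations, and the lower triangular
factors are conjugated by `exp (-i t Im Λ)` and by `exp (t Re Λ)`. -/
theorem todaFlow_chart {ev : Fin n → ℂ} (hev : Function.Injective ev) {g : Mat n}
    (hg : IsFact g) (t : ℝ) : todaFlow ev g t ∈ chartDomain (Matrix.diagonal ev) ∧
      chart (Matrix.diagonal ev) (todaFlow ev g t) =
        linFlow ev (chart (Matrix.diagonal ev) (g⁻¹ * Matrix.diagonal ev * g)) t := by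
  have hdet := hg.det_ne_zero
  have hK := todaK_unitary ev hdet t
  have hV := todaV_posUpper ev hdet t
  have hgK : g * todaK ev g t =
      Matrix.diagonal (fun i => Complex.exp (t * ev i)) * (g * todaV ev g t) := by
    rw [todaK, expConj, ← mul_assoc, mul_conj_eq hdet, mul_assoc]
  have hflow : todaFlow ev g t =
      (g * todaK ev g t)⁻¹ * Matrix.diagonal ev * (g * todaK ev g t) := by
    rw [todaFlow, Matrix.mul_inv_rev, Matrix.inv_eq_right_inv hK]
    simp only [mul_assoc]
  generalize todaK ev g t = K at *
  generalize todaV ev g t = V at *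
  obtain ⟨⟨l₁, k, hl₁, hk, h₁⟩, l₂, v, hl₂, hv, h₂⟩ := hg
  -- The diagonal entries of `exp (-i t Im Λ)` and of `exp (t Re Λ)`.
  set a : Fin n → ℂ := fun i => Complex.exp (-(t * (Complex.I * ((ev i).im : ℂ)))) with ha
  set b : Fin n → ℂ := fun i => Complex.exp (t * ((ev i).re : ℂ)) with hb
  have ha0 : ∀ i, a i ≠ 0 := fun i => Complex.exp_ne_zero _
  have hb0 : ∀ i, b i ≠ 0 := fun i => Complex.exp_ne_zero _
  have hbpos : ∀ i, 0 < b i := fun i => by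
    rw [hb]
    dsimp only
    rw [← Complex.ofReal_mul, ← Complex.ofReal_exp]
    exact_mod_cast Real.exp_pos _
  have hastar : Matrix.diagonal a * (Matrix.diagonal a)ᴴ = 1 := by
    rw [Matrix.diagonal_conjTranspose, Matrix.diagonal_mul_diagonal, ← Matrix.diagonal_one]
    congr 1
    funext i
    simp only [ha, Pi.star_apply, Complex.star_def, ← Complex.exp_conj, ← Complex.exp_add]
    simp
  have hab : Matrix.diagonal a * Matrix.diagonal (fun i => Complex.exp (t * ev i)) =
      Matrix.diagonal b := by
    rw [Matrix.diagonal_mul_diagonal]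
    congr 1
    funext i
    rw [ha, hb]
    dsimp only
    rw [← Complex.exp_add]
    congr 1
    nth_rewrite 2 [← Complex.re_add_im (ev i)]
    ring
  have ia := diagonal_inv_mul_diagonal ha0
  have ib := diagonal_inv_mul_diagonal hb0
  have hk' : (Matrix.diagonal a * (k * K)) * (Matrix.diagonal a * (k * K))ᴴ = 1 := by
    calc _ = Matrix.diagonal a * (k * (K * Kᴴ) * kᴴ) * (Matrix.diagonal a)ᴴ := by
          simp only [Matrix.conjTranspose_mul, mul_assoc]
      _ = 1 := by rw [hK, mul_one, hk, mul_one, hastar]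
  have hv' : PosUpper (Matrix.diagonal b * (v * V)) :=
    ⟨(blockTriangular_diagonal _).mul (hv.mul hV).1, fun i => by
      rw [Matrix.diagonal_mul]; exact mul_pos (hbpos i) ((hv.mul hV).2 i)⟩
  have e1 : (Matrix.diagonal a * l₁ * Matrix.diagonal fun i => (a i)⁻¹) *
      (Matrix.diagonal a * (k * K)) = Matrix.diagonal a * (g * K) := by
    rw [mul_assoc, ← mul_assoc _ (Matrix.diagonal a), ia, one_mul, h₁]
    simp only [mul_assoc]
  have e2 : (Matrix.diagonal b * l₂ * Matrix.diagonal fun i => (b i)⁻¹) *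
      (Matrix.diagonal b * (v * V)) = Matrix.diagonal a * (g * K) := by
    rw [mul_assoc, ← mul_assoc _ (Matrix.diagonal b), ib, one_mul, hgK, ← mul_assoc _ _ (g * V),
      hab, h₂]
    simp only [mul_assoc]
  have hchart := chart_eq_of_factors hev (hl₁.diagonal_conj ha0) hk' (hl₂.diagonal_conj hb0) hv'
    (e1.trans e2.symm)
  have hconj : (Matrix.diagonal a * (g * K))⁻¹ * Matrix.diagonal ev * (Matrix.diagonal a * (g * K))
      = (g * K)⁻¹ * Matrix.diagonal ev * (g * K) := by
    have h3 : (Matrix.diagonal a)⁻¹ * Matrix.diagonal ev * Matrix.diagonal a =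
        Matrix.diagonal ev := by
      rw [Matrix.inv_eq_left_inv ia, Matrix.diagonal_mul_diagonal, Matrix.diagonal_mul_diagonal]
      congr 1
      funext i
      field_simp [ha0 i]
    rw [Matrix.mul_inv_rev]
    calc _ = (g * K)⁻¹ * ((Matrix.diagonal a)⁻¹ * Matrix.diagonal ev * Matrix.diagonal a) *
          (g * K) := by simp only [mul_assoc]
      _ = _ := by rw [h3]
  have hchart₀ := chart_eq_of_factors hev hl₁ hk hl₂ hv (h₁.symm.trans h₂)
  rw [hflow, ← hconj]
  refine ⟨mem_chartDomain_iff.2 ⟨_, ⟨⟨_, _, hl₁.diagonal_conj ha0, hk', e1.symm⟩,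
    _, _, hl₂.diagonal_conj hb0, hv', e2.symm⟩, rfl⟩, ?_⟩
  rw [← e2, hchart, diagonal_conj_inv ha0, diagonal_conj_inv hb0, h₂, hchart₀]
  refine Prod.ext ?_ ?_ <;> ext i j
  · simp only [linFlow, Matrix.of_apply]
    rw [Matrix.mul_diagonal, Matrix.diagonal_mul, ha]
    dsimp only
    rw [← Complex.exp_neg, mul_right_comm, ← Complex.exp_add]
    congr 2
    rw [Complex.sub_im]
    push_cast
    ring
  · simp only [linFlow, Matrix.of_apply]
    rw [Matrix.mul_diagonal, Matrix.diagonal_mul, hb]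
    dsimp only
    rw [← Complex.exp_neg, mul_right_comm, ← Complex.exp_add]
    congr 2
    rw [Complex.sub_re]
    push_cast
    ring

theorem pushesForward_chart {ev : Fin n → ℂ} (hev : Function.Injective ev) :
    PushesForward (chart (Matrix.diagonal ev)) (chartDomain (Matrix.diagonal ev)) toda
      (linField (Matrix.diagonal ev)) := by
  intro X hX
  have hdiff := (analyticWithinAt_chart hev hX).differentiableWithinAt.hasFDerivWithinAt.mono
    (Set.subset_insert X _)
  obtain ⟨g, hg, rfl⟩ := mem_chartDomain_iff.1 hX
  -- The curve `todaFlow` stays in the chart domain and is tangent to the Toda field at `t = 0`.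
  have hd := hasDerivAt_todaFlow ev hg.det_ne_zero
  have h0 := todaFlow_zero ev hg.det_ne_zero
  constructor
  · have h1 := hd.hasFDerivAt.hasFDerivWithinAt (s := univ) |>.mapsTo_tangent_cone
    rw [tangentConeAt_univ, h0] at h1
    have h2 : (1 : ℝ) • toda (g⁻¹ * Matrix.diagonal ev * g) ∈
        tangentConeAt ℝ (todaFlow ev g '' univ) (g⁻¹ * Matrix.diagonal ev * g) := h1 (mem_univ 1)
    rw [one_smul] at h2
    refine tangentConeAt_mono ?_ h2
    rintro _ ⟨t, -, rfl⟩
    exact (todaFlow_chart hev hg t).1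
  · refine ⟨_, hdiff, ?_⟩
    have h1 := hdiff.comp_hasDerivAt_of_eq (0 : ℝ) hd
      (Filter.Eventually.of_forall fun t => (todaFlow_chart hev hg t).1) h0.symm
    have h2 := hasDerivAt_linFlow ev
      (chart (Matrix.diagonal ev) (g⁻¹ * Matrix.diagonal ev * g)) 0
    rw [linFlow_zero] at h2
    refine h1.unique (h2.congr_of_eventuallyEq (Filter.Eventually.of_forall fun t => ?_))
    exact (todaFlow_chart hev hg t).2

end TodaYZ

theorem mainTheorem7 (n : ℕ) (X₀ : Mat n) (htrace : X₀.trace = 0) (hsimple : HasSimpleSpectrum X₀)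
    (ev : Fin n → ℂ) (Λ : Mat n) (hdiag : Λ = Matrix.diagonal ev) (hΛ : Λ ∈ conjClass X₀) :
    -- the two parametrizations are injective with the same image, an open subset of the class
    (InjOn (phiC Λ) (setC n ×ˢ grpL n) ∧ InjOn (phiD Λ) (setD n ×ˢ grpL n) ∧
      phiD Λ '' (setD n ×ˢ grpL n) = chartDomain Λ ∧
      (∃ V : Set (Mat n), IsOpen V ∧ chartDomain Λ = conjClass X₀ ∩ V) ∧
      Λ ∈ chartDomain Λ ∧ chart Λ Λ = (Λ, Λ)) ∧
    -- the variables are a real analytic diffeomorphism onto the whole affine space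
    (BijOn (chart Λ) (chartDomain Λ) (affineLower Λ ×ˢ affineLower Λ) ∧
      AnalyticOn ℝ (chart Λ) (chartDomain Λ) ∧
      ∃ ψ : Mat n × Mat n → Mat n,
        MapsTo ψ (affineLower Λ ×ˢ affineLower Λ) (chartDomain Λ) ∧
        InvOn ψ (chart Λ) (chartDomain Λ) (affineLower Λ ×ˢ affineLower Λ) ∧
        AnalyticOn ℝ ψ (affineLower Λ ×ˢ affineLower Λ)) ∧
    -- the Toda vector field in these variables
    PushesForward (chart Λ) (chartDomain Λ) toda (linField Λ) ∧
    -- the linear field is a vector field on the whole affine space, with all trajectories global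
    ((∀ p ∈ affineLower Λ ×ˢ affineLower Λ,
        (linField Λ p).1 ∈ strictLower n ∧ (linField Λ p).2 ∈ strictLower n) ∧
      (∀ p ∈ affineLower Λ ×ˢ affineLower Λ, ∃! γ : ℝ → Mat n × Mat n,
        IsTrajectory (linField Λ) (affineLower Λ ×ˢ affineLower Λ) γ ∧ γ 0 = p)) ∧
    -- compactness of the projections of the trajectories
    (∀ γ : ℝ → Mat n × Mat n,
      IsTrajectory (linField Λ) (affineLower Λ ×ˢ affineLower Λ) γ →
        IsCompact (closure (Set.range fun t => (γ t).1)) ∧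
        (IsCompact (Set.range fun t => (γ t).2) ↔ ∀ t, (γ t).2 = (γ 0).2)) ∧
    -- decoupling in the strictly lower triangular entries
    (∀ p ∈ affineLower Λ ×ˢ affineLower Λ, ∀ j k : Fin n, k < j →
      (linField Λ p).1 j k = Complex.I * ((ev k - ev j).im : ℂ) * p.1 j k ∧
      (linField Λ p).2 j k = ((ev j - ev k).re : ℂ) * p.2 j k) := by
  subst hdiag
  have hev := injective_of_hasSimpleSpectrum hsimple hΛ
  have hone : IsFact (1 : Mat n) :=
    ⟨⟨1, 1, UnitLower.one, by simp, by simp⟩, 1, 1, UnitLower.one,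
      ⟨blockTriangular_one, fun i => by simp⟩, by simp⟩
  have hΛ1 : (1 : Mat n)⁻¹ * Matrix.diagonal ev * 1 = Matrix.diagonal ev := by simp
  have hmem : Matrix.diagonal ev ∈ chartDomain (Matrix.diagonal ev) :=
    mem_chartDomain_iff.2 ⟨1, hone, hΛ1.symm⟩
  have hcenter : chart (Matrix.diagonal ev) (Matrix.diagonal ev) =
      (Matrix.diagonal ev, Matrix.diagonal ev) := by
    have h := chart_eq_of_factors hev (l₁ := 1) (k := 1) (l₂ := 1) (v := 1) UnitLower.one (by simp)
      UnitLower.one ⟨blockTriangular_one, fun i => by simp⟩ rfl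
    simpa using h
  have hinv : InvOn (chartInv ev) (chart (Matrix.diagonal ev)) (chartDomain (Matrix.diagonal ev))
      (affineLower (Matrix.diagonal ev) ×ˢ affineLower (Matrix.diagonal ev)) :=
    ⟨fun X hX => (chart_mem hev hX).2, fun p hp => (chartInv_mem hev hp).2⟩
  have hmaps : MapsTo (chartInv ev)
      (affineLower (Matrix.diagonal ev) ×ˢ affineLower (Matrix.diagonal ev))
      (chartDomain (Matrix.diagonal ev)) := fun p hp => (chartInv_mem hev hp).1
  refine ⟨⟨injOn_phiC hev, injOn_phiD hev, image_phiD_eq _, exists_isOpen_chartDomain hev hΛ,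
      hmem, hcenter⟩,
    ⟨hinv.bijOn (fun X hX => (chart_mem hev hX).1) hmaps, fun X hX => analyticWithinAt_chart hev hX,
      chartInv ev, hmaps, hinv, fun p hp => (analyticAt_chartInv hev hp).analyticWithinAt⟩,
    pushesForward_chart hev,
    ⟨fun p hp => linField_mem hp, fun p hp => existsUnique_trajectory hp⟩,
    fun γ hγ => ?_,
    fun p _ j k _ => ⟨linField_fst ev p j k, linField_snd ev p j k⟩⟩
  have hflow : γ = linFlow ev (γ 0) := funext hγ.eq_linFlow
  rw [hflow, linFlow_zero]
  exact ⟨isCompact_closure_linFlow_fst ev _, isCompact_linFlow_snd_iff ev _⟩
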